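/- **Equivalence of iterative Dirichlet-copula sampling.** Let $U[0,1]$ be the uniform distribution and $\mathrm{Gamma}[n,1]$ the distribution with density $x^{n-1}e^{-x}/(n-1)!$ on $x\ge 0$. *Original sampling.* For $n\ge 1$ draw $U^{(1)},\dots,U^{(n)}$ i.i.d. from $U[0,1]$ and put $$E^{(s)}=-\log U^{(s)},\qquad d^{(s)}=\frac{\log U^{(s)}}{\sum_{s'=1}^n\log U^{(s')}}=\frac{E^{(s)}}{\sum_{s'=1}^nE^{(s')}},\qquad \tilde u^{(s)}=1-(1-d^{(s)})^{n-1}.$$ *Iterative sampling.* Draw $T\sim\mathrm{Gamma}[n,1]$ and, independently, $V_1,\dots,V_{n-1}$ i.i.d. from $U[0,1]$. Put $R_0=T$ and, for $s=1,\dots,n$, $$E_*^{(s)}=\begin{cases}R_{s-1}-R_{s-1}V_s^{1/(n-s)}&(s<n)\\ R_{s-1}&(s=n)\end{cases},\qquad R_s=R_{s-1}-E_*^{(s)},\qquad d_*^{(s)}=\frac{E_*^{(s)}}{T},\qquad \tilde u_*^{(s)}=1-(1-d_*^{(s)})^{n-1}.$$ **(A)** For every $n\ge 1$: 1. $\sum_{s=1}^nE^{(s)}\sim\mathrm{Gamma}[n,1]$;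 2. for every $s<n$, the conditional distribution of $E^{(s)}$ given the remaining sum $\sum_{s'\ge s}E^{(s')}=r$ is, for almost every $r$ with respect to the law of this sum, the distribution of $r-rV^{1/(n-s)}$ with $V\sim U[0,1]$; 3. $\sum_{s=1}^nE_*^{(s)}=T$ always; 4. the random vectors $(E_*^{(s)})_{s=1}^n$, $(d_*^{(s)})_{s=1}^n$, $(\tilde u_*^{(s)})_{s=1}^n$ have the same joint distributions as $(E^{(s)})_{s=1}^n$, $(d^{(s)})_{s=1}^n$, $(\tilde u^{(s)})_{s=1}^n$, respectively. *ARMS.* Let $d\ge1$, $n\ge2$, $J:\{0,1\}^d\to\mathbb R$, $\theta\in(0,1)^d$ and $p_\theta(z)=\prod_i\theta_i^{z_i}(1-\theta_i)^{1-z_i}$. The *original ARMS estimator* draws, independently for every $i\in\{1,\dots,d\}$, variables $\tilde u_i^{(1)},\dots,\tilde u_i^{(n)}$ by the original sampling; if $\theta_i>1/2$ it puts $\tilde z_i^{(s)}=\mathbf 1[\tilde u_i^{(s)}\le\theta_i]$ and $q_i=1-\theta_i$, and otherwise $\tilde z_i^{(s)}=\mathbf 1[1-\tilde u_i^{(s)}\le\theta_i]$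 and $q_i=\theta_i$; it puts $$\rho_i=\frac{\max(0,2q_i^{1/(n-1)}-1)^{n-1}-q_i^2}{\theta_i(1-\theta_i)}$$ and returns the vector $\hat g$ with coordinates $$\hat g_i=\frac1{1-\rho_i}\cdot\frac1n\sum_{s=1}^n\Big(J(\tilde z^{(s)})-\frac1{n-1}\sum_{s'\ne s}J(\tilde z^{(s')})\Big)\frac{\partial\log p_\theta}{\partial\theta_i}(\tilde z^{(s)}).$$ The *iterative ARMS algorithm* first draws, for each $i$, a total $T_i\sim\mathrm{Gamma}[n,1]$, computes $\rho_i$, and sets $\bar J=0$, $\Lambda=\Lambda^J=0\in\mathbb R^d$. For $s=1,\dots,n$ it performs, for each $i$, the $s$-th round of the iterative sampling with fresh uniforms (keeping only $T_i$ and the current remaining sum $R_i$), obtains $\tilde z_i^{(s)}$ from $\tilde u_i^{(s)}$ as above, evaluates $J(\tilde z^{(s)})$ and updates $$\bar J\leftarrow\tfrac{s-1}s\bar J+\tfrac1sJ(\tilde z^{(s)}),\qquad \Lambda\leftarrow\tfrac{\max(s-2,1)}{\max(s-1,1)}\Lambda+\tfrac1{\max(s-1,1)}\nabla_\theta\log p_\theta(\tilde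 z^{(s)}),$$ $$\Lambda^J\leftarrow\tfrac{\max(s-2,1)}{\max(s-1,1)}\Lambda^J+\tfrac1{\max(s-1,1)}J(\tilde z^{(s)})\nabla_\theta\log p_\theta(\tilde z^{(s)}).$$ It returns the vector with coordinates $\frac1{1-\rho_i}(\Lambda^J_i-\Lambda_i\bar J)$. It is implemented as a program of a randomized machine with real registers, whose instructions are arithmetic assignments, comparisons, `for` loops, sampling from $U[0,1]$ and from $\mathrm{Gamma}[m,1]$ with natural $m$, and queries to an oracle for $J$. The score is computed coordinatewise as $z_i/\theta_i-(1-z_i)/(1-\theta_i)$. The inputs are $n$ and $\theta$, and the program depends only on $d$. Its memory is the number of registers plus the scratch space for intermediate results, the arguments of a query and loop control, counted in real numbers; memory used inside the oracle is not counted. **(B)** There is a constant $C$ such that for every $d\ge1$ the iterative ARMS program uses memory at most $C\,d$ (independently of the number of samples $n$), and for all $n\ge2$, $J:\{0,1\}^d\to\mathbb R$ and $\theta\in(0,1)^d$ its output has the same distribution as the original ARMS estimator. -/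

import Mathlib

open MeasureTheory ProbabilityTheory

noncomputable section

namespace ARMS

/-! ### Sampling the Dirichlet copula -/

/-- The uniform distribution `U[0,1]`, as a measure on `ℝ`. -/
def unif : Measure ℝ := (volume : Measure ℝ).restrict (Set.Icc 0 1)

instance : IsProbabilityMeasure unif := ⟨by simp [unif]⟩

/-- The law of `n` i.i.d. uniforms. -/
def iidUnif (n : ℕ) : Measure (Fin n → ℝ) := Measure.pi fun _ => unif

instance (n : ℕ) : IsProbabilityMeasure (iidUnif n) := by
  unfold iidUnif; infer_instance

/-- `E^{(s)} = - log U^{(s)}`. -/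
def origE {n : ℕ} (u : Fin n → ℝ) (s : Fin n) : ℝ := -Real.log (u s)

/-- `d^{(s)} = log U^{(s)} / ∑_{s'} log U^{(s')}`. -/
def origDir {n : ℕ} (u : Fin n → ℝ) (s : Fin n) : ℝ :=
  Real.log (u s) / ∑ t, Real.log (u t)

/-- The marginal distribution function of a Dirichlet variable, applied to each coordinate. -/
def copula {n : ℕ} (x : Fin n → ℝ) (s : Fin n) : ℝ := 1 - (1 - x s) ^ (n - 1)

/-- The inverse-transform draw `r - r v ^ (1 / (n - s))`. -/
def invDraw (n s : ℕ) (r v : ℝ) : ℝ := r - r * v ^ (1 / ((n : ℝ) - s))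

/-- The draw made in round `s = k + 1` of the iterative procedure when the remaining sum is `r`:
an inverse-transform draw while `s < n`, and the whole remaining sum in the last round. -/
def iterDraw (n : ℕ) (v : Fin (n - 1) → ℝ) (k : ℕ) (r : ℝ) : ℝ :=
  if h : k < n - 1 then invDraw n (k + 1) r (v ⟨k, h⟩) else r

/-- The remaining sum after `k` rounds, started from the total `T`. -/
def iterRem (n : ℕ) (T : ℝ) (v : Fin (n - 1) → ℝ) : ℕ → ℝ
  | 0 => T
  | k + 1 => iterRem n T v k - iterDraw n v k (iterRem n T v k)

/-- The summands `E^{(1)}, …, E^{(n)}` produced by the iterative procedure. -/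
def iterE {n : ℕ} (p : ℝ × (Fin (n - 1) → ℝ)) (s : Fin n) : ℝ :=
  iterDraw n p.2 s (iterRem n p.1 p.2 s)

/-- The Dirichlet variables produced by the iterative procedure: each summand is divided by the
total, which was sampled first. -/
def iterDir {n : ℕ} (p : ℝ × (Fin (n - 1) → ℝ)) (s : Fin n) : ℝ := iterE p s / p.1

/-- The randomness of the iterative procedure: the total is drawn from `Gamma[n,1]`, and,
independently, `n - 1` i.i.d. uniforms are drawn. -/
def iterSource (n : ℕ) : Measure (ℝ × (Fin (n - 1) → ℝ)) :=
  (gammaMeasure n 1).prod (iidUnif (n - 1))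

/-! ### The original ARMS estimator -/

/-- The product Bernoulli probability `p_θ(z)`. -/
def bernProb {d : ℕ} (θ : Fin d → ℝ) (z : Fin d → Bool) : ℝ :=
  ∏ i, if z i then θ i else 1 - θ i

/-- The score `∇_θ log p_θ(z)`, as the vector of partial derivatives. -/
def score {d : ℕ} (θ : Fin d → ℝ) (z : Fin d → Bool) (i : Fin d) : ℝ :=
  deriv (fun t => Real.log (bernProb (Function.update θ i t) z)) (θ i)

/-- The leave-one-out estimator. -/
def loorf {d n : ℕ} (J : (Fin d → Bool) → ℝ) (θ : Fin d → ℝ) (z : Fin n → Fin d → Bool)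
    (i : Fin d) : ℝ :=
  (1 / (n : ℝ)) * ∑ s, (J (z s) - (1 / ((n : ℝ) - 1)) * ∑ t ∈ Finset.univ.erase s, J (z t)) *
    score θ (z s) i

/-- The correlation correction for a coordinate with parameter `t`. -/
def armsRho (n : ℕ) (t : ℝ) : ℝ :=
  if t > 1 / 2 then
    (max 0 (2 * (1 - t) ^ (1 / ((n : ℝ) - 1)) - 1) ^ (n - 1) - (1 - t) ^ 2) / (t * (1 - t))
  else
    (max 0 (2 * t ^ (1 / ((n : ℝ) - 1)) - 1) ^ (n - 1) - t ^ 2) / (t * (1 - t))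

open Classical in
/-- The Bernoulli sample obtained from a copula uniform `w` for the parameter `t`. -/
def armsBit (t w : ℝ) : Bool :=
  if t > 1 / 2 then decide (w ≤ t) else decide (1 - w ≤ t)

/-- The original ARMS estimator with Dirichlet copulas, as a function of the `d × n` uniforms. -/
def origARMS {d n : ℕ} (J : (Fin d → Bool) → ℝ) (θ : Fin d → ℝ) (u : Fin d → Fin n → ℝ)
    (i : Fin d) : ℝ :=
  1 / (1 - armsRho n (θ i)) *
    loorf J θ (fun s j => armsBit (θ j) (copula (origDir (u j)) s)) i

/-- The law of the original ARMS estimator, from `d × n` i.i.d. uniforms. -/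
def origARMSLaw (d n : ℕ) (J : (Fin d → Bool) → ℝ) (θ : Fin d → ℝ) : Measure (Fin d → ℝ) :=
  (Measure.pi fun _ : Fin d => iidUnif n).map (origARMS J θ)

/-! ### A randomized machine with real registers -/

/-- Arithmetic expressions over the registers `ι`. -/
inductive Expr (ι : Type) : Type
  | const (m : ℕ)
  | reg (x : ι)
  | add (a b : Expr ι)
  | sub (a b : Expr ι)
  | mul (a b : Expr ι)
  | div (a b : Expr ι)
  | pow (a b : Expr ι)
  | max (a b : Expr ι)

namespace Expr

variable {ι : Type}

/-- The value of an expression in a machine state. -/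
def eval : Expr ι → (ι → ℝ) → ℝ
  | const m, _ => m
  | reg x, σ => σ x
  | add a b, σ => a.eval σ + b.eval σ
  | sub a b, σ => a.eval σ - b.eval σ
  | mul a b, σ => a.eval σ * b.eval σ
  | div a b, σ => a.eval σ / b.eval σ
  | pow a b, σ => a.eval σ ^ b.eval σ
  | max a b, σ => Max.max (a.eval σ) (b.eval σ)

/-- The number of nodes; it bounds the number of intermediate results kept in an evaluation. -/
def size : Expr ι → ℕ
  | const _ => 1
  | reg _ => 1
  | add a b => a.size + b.size + 1
  | sub a b => a.size + b.size + 1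
  | mul a b => a.size + b.size + 1
  | div a b => a.size + b.size + 1
  | pow a b => a.size + b.size + 1
  | max a b => a.size + b.size + 1

theorem measurable_eval (e : Expr ι) : Measurable e.eval := by
  induction e with
  | const m => exact measurable_const
  | reg x => exact measurable_pi_apply x
  | add a b iha ihb => exact iha.add ihb
  | sub a b iha ihb => exact iha.sub ihb
  | mul a b iha ihb => exact iha.mul ihb
  | div a b iha ihb => exact iha.div ihb
  | pow a b iha ihb => exact iha.pow ihb
  | max a b iha ihb => exact iha.max ihb

end Expr

/-- Commands of a machine with the registers `ι`, which can query an oracle for a function on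
`{0,1}^d`. -/
inductive Cmd (ι : Type) (d : ℕ) : Type
  | skip
  /-- `x ← e`. -/
  | assign (x : ι) (e : Expr ι)
  /-- Sample `x ∼ U[0,1]`. -/
  | uniform (x : ι)
  /-- Sample `x ∼ Gamma[m,1]`, with `m` the natural number stored in `b`. -/
  | gamma (x b : ι)
  /-- `x ← J(z)`, where the `i`-th bit of `z` is one iff the register `z i` holds one. -/
  | query (x : ι) (z : Fin d → ι)
  | seq (c₁ c₂ : Cmd ι d)
  /-- If `a ≤ b` then `c₁` else `c₂`. -/
  | ite (a b : Expr ι) (c₁ c₂ : Cmd ι d)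
  /-- For `x = 1, …, m` do `c`, with `m` the natural number stored in `b`. -/
  | loop (x b : ι) (c : Cmd ι d)

open Classical in
/-- The bits held by the registers `z`. -/
def bits {ι : Type} {d : ℕ} (z : Fin d → ι) (σ : ι → ℝ) (i : Fin d) : Bool :=
  decide (σ (z i) = 1)

theorem measurable_bits {ι : Type} {d : ℕ} (z : Fin d → ι) : Measurable (bits z) := by
  classical
  refine measurable_pi_iff.2 fun i => ?_
  refine measurable_to_bool ?_
  have h : (fun σ : ι → ℝ => bits z σ i) ⁻¹' {true} = {σ | σ (z i) = 1} := by
    ext σ; simp [bits]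
  rw [h]
  exact measurableSet_eq_fun (measurable_pi_apply (z i)) measurable_const

/-- The distribution `Gamma[m,1]`; for `m = 0` it is the point mass at `0`. -/
def gammaNat (m : ℕ) : Measure ℝ := if m = 0 then Measure.dirac 0 else gammaMeasure m 1

instance (m : ℕ) : IsProbabilityMeasure (gammaNat m) := by
  unfold gammaNat
  split_ifs with h
  · infer_instance
  · exact isProbabilityMeasure_gammaMeasure (by positivity) one_pos

/-- The kernel that samples `Gamma[m,1]`, with `m` the natural number stored in `b`. -/
def gammaKernel {ι : Type} (b : ι) : Kernel (ι → ℝ) ℝ where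
  toFun σ := gammaNat ⌊σ b⌋₊
  measurable' := (measurable_from_top (f := gammaNat)).comp
    (Nat.measurable_floor.comp (measurable_pi_apply b))

instance {ι : Type} (b : ι) : IsMarkovKernel (gammaKernel b) :=
  ⟨fun σ => inferInstanceAs (IsProbabilityMeasure (gammaNat ⌊σ b⌋₊))⟩

section Semantics

variable {ι : Type} [DecidableEq ι]

/-- Store in the register `x` a value drawn from a kernel. -/
def storeKernel (x : ι) (κ : Kernel (ι → ℝ) ℝ) : Kernel (ι → ℝ) (ι → ℝ) :=
  (Kernel.id ×ₖ κ).map fun p => Function.update p.1 x p.2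

/-- Store in the register `x` a measurable function of the state. -/
def storeFun (x : ι) (f : (ι → ℝ) → ℝ) (hf : Measurable f) : Kernel (ι → ℝ) (ι → ℝ) :=
  Kernel.deterministic (fun σ => Function.update σ x (f σ)) <| by
    refine measurable_pi_iff.2 fun y => ?_
    by_cases h : y = x
    · subst h; simpa using hf
    · simpa [Function.update_of_ne h] using measurable_pi_apply y

/-- The kernel of `m` rounds of a loop with counter `x` and body `κ`. -/
def rounds (x : ι) (κ : Kernel (ι → ℝ) (ι → ℝ)) : ℕ → Kernel (ι → ℝ) (ι → ℝ)
  | 0 => Kernel.id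
  | m + 1 => κ ∘ₖ storeFun x (fun _ => ((m + 1 : ℕ) : ℝ)) measurable_const ∘ₖ rounds x κ m

/-- The kernel of a loop whose number of rounds is stored in the register `b` on entry. -/
def loopKernel (x b : ι) (κ : Kernel (ι → ℝ) (ι → ℝ)) : Kernel (ι → ℝ) (ι → ℝ) where
  toFun σ := rounds x κ ⌊σ b⌋₊ σ
  measurable' := by
    have h : Measurable fun p : ℕ × (ι → ℝ) => rounds x κ p.1 p.2 :=
      measurable_from_prod_countable_right fun m => (rounds x κ m).measurable
    exact h.comp ((Nat.measurable_floor.comp (measurable_pi_apply b)).prodMk measurable_id)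

end Semantics

namespace Cmd

variable {ι : Type} {d : ℕ}

open Classical in
/-- The semantics of a command: the Markov kernel which sends an initial state to the law of the
final state. All samples are drawn with fresh randomness. -/
def run [DecidableEq ι] (J : (Fin d → Bool) → ℝ) : Cmd ι d → Kernel (ι → ℝ) (ι → ℝ)
  | skip => Kernel.id
  | assign x e => storeFun x e.eval e.measurable_eval
  | uniform x => storeKernel x (Kernel.const _ unif)
  | gamma x b => storeKernel x (gammaKernel b)
  | query x z => storeFun x (fun σ => J (bits z σ))
      ((measurable_of_finite J).comp (measurable_bits z))
  | seq c₁ c₂ => c₂.run J ∘ₖ c₁.run J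
  | ite a b c₁ c₂ =>
      Kernel.piecewise (measurableSet_le a.measurable_eval b.measurable_eval)
        (c₁.run J) (c₂.run J)
  | loop x b c => loopKernel x b (c.run J)

/-- The working memory used in addition to the registers: intermediate results of expressions, a
buffer for the argument of an oracle query, and the position and the length of every loop that is
being executed. -/
def scratch : Cmd ι d → ℕ
  | skip => 0
  | assign _ e => e.size
  | uniform _ => 1
  | gamma _ _ => 1
  | query _ _ => d + 1
  | seq c₁ c₂ => max c₁.scratch c₂.scratch
  | ite a b c₁ c₂ => max (a.size + b.size) (max c₁.scratch c₂.scratch)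
  | loop _ _ c => c.scratch + 2

/-- The memory of a program, in real numbers: its registers and its additional working memory. -/
def memory [Fintype ι] (c : Cmd ι d) : ℕ := Fintype.card ι + c.scratch

/-- Execute a list of commands in order. -/
def block : List (Cmd ι d) → Cmd ι d
  | [] => skip
  | c :: l => seq c (block l)

/-- For `i = 1, …, d` do `f i`. -/
def forDim (f : Fin d → Cmd ι d) : Cmd ι d := block ((List.finRange d).map f)

end Cmd

/-! ### The iterative ARMS program -/

/-- Names of the vectors of length `d`: the parameter, the sampled total, the remaining sum, the
correlation, the current sample, the accumulators of the score and of `J` times the score, and the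
output. -/
inductive VecName : Type
  | theta | total | rem | rho | z | accS | accJS | g
  deriving DecidableEq

instance : Fintype VecName :=
  ⟨{.theta, .total, .rem, .rho, .z, .accS, .accJS, .g}, fun x => by cases x <;> decide⟩

/-- Names of the scalars: the number of samples, the loop counter, a uniform sample, the current
summand, the current Dirichlet variable, the current copula uniform, the value of `J` at the
current sample, and the running mean of these values. -/
inductive ScalName : Type
  | n | s | u | e | dir | w | j | meanJ
  deriving DecidableEq

instance : Fintype ScalName :=
  ⟨{.n, .s, .u, .e, .dir, .w, .j, .meanJ}, fun x => by cases x <;> decide⟩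

/-- The registers of the iterative ARMS program in dimension `d`. -/
abbrev Reg (d : ℕ) : Type := (VecName × Fin d) ⊕ ScalName

section Program

variable {d : ℕ}

/-- The scalar register with a given name. -/
abbrev S (a : ScalName) : Reg d := Sum.inr a

/-- The `i`-th register of the vector with a given name. -/
abbrev V (a : VecName) (i : Fin d) : Reg d := Sum.inl (a, i)

/-- The content of a scalar register. -/
abbrev rs (a : ScalName) : Expr (Reg d) := .reg (S a)

/-- The content of a vector register. -/
abbrev rv (a : VecName) (i : Fin d) : Expr (Reg d) := .reg (V a i)

/-- `(max(0, 2 t^{1/(n-1)} - 1)^{n-1} - t²) / (θ_i (1 - θ_i))`. -/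
def rhoExpr (i : Fin d) (t : Expr (Reg d)) : Expr (Reg d) :=
  .div
    (.sub
      (.pow
        (.max (.const 0)
          (.sub (.mul (.const 2) (.pow t (.div (.const 1) (.sub (rs .n) (.const 1)))))
            (.const 1)))
        (.sub (rs .n) (.const 1)))
      (.mul t t))
    (.mul (rv .theta i) (.sub (.const 1) (rv .theta i)))

/-- Compute the correlation of coordinate `i`. -/
def rhoCmd (i : Fin d) : Cmd (Reg d) d :=
  .ite (rv .theta i) (.div (.const 1) (.const 2))
    (.assign (V .rho i) (rhoExpr i (rv .theta i)))
    (.assign (V .rho i) (rhoExpr i (.sub (.const 1) (rv .theta i))))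

/-- Sample bit `i` of the current sample. -/
def sampleCmd (i : Fin d) : Cmd (Reg d) d := .block [
  .ite (rs .n) (rs .s)
    (.assign (S .e) (rv .rem i))
    (.seq (.uniform (S .u))
      (.assign (S .e) (.sub (rv .rem i)
        (.mul (rv .rem i) (.pow (rs .u) (.div (.const 1) (.sub (rs .n) (rs .s)))))))),
  .assign (V .rem i) (.sub (rv .rem i) (rs .e)),
  .assign (S .dir) (.div (rs .e) (rv .total i)),
  .assign (S .w)
    (.sub (.const 1) (.pow (.sub (.const 1) (rs .dir)) (.sub (rs .n) (.const 1)))),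
  .ite (rv .theta i) (.div (.const 1) (.const 2))
    (.ite (.sub (.const 1) (rs .w)) (rv .theta i)
      (.assign (V .z i) (.const 1)) (.assign (V .z i) (.const 0)))
    (.ite (rs .w) (rv .theta i)
      (.assign (V .z i) (.const 1)) (.assign (V .z i) (.const 0)))]

/-- The `i`-th partial derivative of `log p_θ(z) = ∑ z log θ + (1 - z) log (1 - θ)`. -/
def scoreExpr (i : Fin d) : Expr (Reg d) :=
  .sub (.div (rv .z i) (rv .theta i))
    (.div (.sub (.const 1) (rv .z i)) (.sub (.const 1) (rv .theta i)))

/-- `max(s-2,1)/max(s-1,1) * a + 1/max(s-1,1) * b`. -/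
def accExpr (a b : Expr (Reg d)) : Expr (Reg d) :=
  .add
    (.mul (.div (.max (.sub (rs .s) (.const 2)) (.const 1))
      (.max (.sub (rs .s) (.const 1)) (.const 1))) a)
    (.mul (.div (.const 1) (.max (.sub (rs .s) (.const 1)) (.const 1))) b)

/-- One round of the main loop: draw a sample, query the function and update the accumulators. -/
def roundCmd (d : ℕ) : Cmd (Reg d) d := .block [
  .forDim sampleCmd,
  .query (S .j) (V .z),
  .assign (S .meanJ) (.add
    (.mul (.div (.sub (rs .s) (.const 1)) (rs .s)) (rs .meanJ))
    (.mul (.div (.const 1) (rs .s)) (rs .j))),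
  .forDim fun i => .seq
    (.assign (V .accS i) (accExpr (rv .accS i) (scoreExpr i)))
    (.assign (V .accJS i) (accExpr (rv .accJS i) (.mul (rs .j) (scoreExpr i))))]

/-- The iterative ARMS program. Neither its registers nor its code depend on the number of
samples, which is an input. -/
def iterARMS (d : ℕ) : Cmd (Reg d) d := .block [
  .assign (S .meanJ) (.const 0),
  .forDim fun i => .seq (.assign (V .accS i) (.const 0)) (.assign (V .accJS i) (.const 0)),
  .forDim fun i => .seq (.gamma (V .total i) (S .n)) (.assign (V .rem i) (rv .total i)),
  .forDim rhoCmd,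
  .loop (S .s) (S .n) (roundCmd d),
  .forDim fun i => .assign (V .g i)
    (.mul (.div (.const 1) (.sub (.const 1) (rv .rho i)))
      (.sub (rv .accJS i) (.mul (rv .accS i) (rs .meanJ))))]

/-- The initial state holds the number of samples and the parameter; all other registers are
zero. -/
def initState (n : ℕ) (θ : Fin d → ℝ) : Reg d → ℝ
  | .inl (.theta, i) => θ i
  | .inr .n => n
  | _ => 0

/-- The output vector of a final state. -/
def output (σ : Reg d → ℝ) (i : Fin d) : ℝ := σ (V .g i)

end Program

/-- The law of the output of the iterative ARMS program. -/
def iterARMSLaw (d n : ℕ) (J : (Fin d → Bool) → ℝ) (θ : Fin d → ℝ) : Measure (Fin d → ℝ) :=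
  ((iterARMS d).run J (initState n θ)).map output

end ARMS

end

/-!
A `Gamma[a + b, 1]` variable splits, through an independent `Beta[a, b]` variable, into independent
`Gamma[a, 1]` and `Gamma[b, 1]` variables. For `a = 1` and `b = n - s` the share left to the second
one is `V ^ (1 / (n - s))` with `V` uniform, so each round of the iterative procedure splits an
exponential off the remaining sum, and the `n` summands are i.i.d. exponentials, exactly as in the
original sampling.

The iterative program is compared with a pure function of its sampled totals and uniforms: a kernel
simulates a function driven by noise if it can be realised by a measurable map of that noise which
follows the function on represented states, and this relation is compatible with sequencing and
loops. After `n` rounds the online averages are the averages over all samples, and the leave-one-out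
estimator is their combination `(Λ^J - Λ * mean J) / (1 - ρ)`.
-/

noncomputable section

namespace ARMS

open Real Set Filter
open scoped ENNReal Topology

section Gamma

variable {a b r : ℝ}

@[fun_prop]
theorem measurable_gammaPDF (a r : ℝ) : Measurable (gammaPDF a r) :=
  (measurable_gammaPDFReal a r).ennreal_ofReal

@[fun_prop]
theorem measurable_betaPDF (a b : ℝ) : Measurable (betaPDF a b) :=
  (measurable_betaPDFReal a b).ennreal_ofReal

theorem gammaPDFReal_mul_betaPDFReal_div (ha : 0 < a) (hb : 0 < b) (hr : 0 < r) {g y : ℝ}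
    (hy : 0 < y) (hyg : y < g) :
    gammaPDFReal (a + b) r g * (g⁻¹ * betaPDFReal a b (y / g)) =
      gammaPDFReal a r y * gammaPDFReal b r (g - y) := by
  have hg : 0 < g := hy.trans hyg
  have hgy : 0 < g - y := sub_pos.2 hyg
  have hΓ : Gamma (a + b) ≠ 0 := (Gamma_pos_of_pos (add_pos ha hb)).ne'
  have h_one_sub : 1 - y / g = (g - y) / g := by field_simp
  have h_exp : exp (-(r * g)) = exp (-(r * y)) * exp (-(r * (g - y))) := by
    rw [← exp_add]; ring_nf
  have h_pow : g ^ (a + b - 1) = g ^ (a - 1) * g ^ (b - 1) * g := by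
    rw [← rpow_add hg, ← rpow_add_one hg.ne']; ring_nf
  rw [gammaPDFReal, gammaPDFReal, gammaPDFReal, betaPDFReal, if_pos hg.le, if_pos hy.le,
    if_pos hgy.le, if_pos ⟨div_pos hy hg, (div_lt_one hg).2 hyg⟩, h_one_sub,
    div_rpow hy.le hg.le, div_rpow hgy.le hg.le, rpow_add hr, h_exp, h_pow, beta]
  have := (rpow_pos_of_pos hg (a - 1)).ne'
  have := (rpow_pos_of_pos hg (b - 1)).ne'
  field_simp

theorem gammaPDF_mul_betaPDF_div (ha : 0 < a) (hb : 0 < b) (hr : 0 < r) {g y : ℝ} (hy : y ≠ 0)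
    (hyg : y ≠ g) :
    gammaPDF (a + b) r g * (ENNReal.ofReal g⁻¹ * betaPDF a b (y / g)) =
      gammaPDF a r y * gammaPDF b r (g - y) := by
  rcases le_or_gt g 0 with hg | hg
  · have h_right : gammaPDF a r y * gammaPDF b r (g - y) = 0 := by
      rcases hy.lt_or_gt with hy | hy
      · rw [gammaPDF_of_neg hy, zero_mul]
      · rw [gammaPDF_of_neg (x := g - y) (by linarith), mul_zero]
    rw [h_right, ENNReal.ofReal_of_nonpos (inv_nonpos.2 hg), zero_mul, mul_zero]
  rcases hy.lt_or_gt with hy | hy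
  · rw [gammaPDF_of_neg hy, betaPDF_eq_zero_of_nonpos (div_nonpos_of_nonpos_of_nonneg hy.le hg.le),
      mul_zero, mul_zero, zero_mul]
  rcases hyg.lt_or_gt with hyg | hyg
  · simp only [gammaPDF, betaPDF]
    rw [← ENNReal.ofReal_mul (inv_nonneg.2 hg.le),
      ← ENNReal.ofReal_mul (gammaPDFReal_nonneg (add_pos ha hb) hr g),
      ← ENNReal.ofReal_mul (gammaPDFReal_nonneg ha hr y),
      gammaPDFReal_mul_betaPDFReal_div ha hb hr hy hyg]
  · rw [gammaPDF_of_neg (sub_neg.2 hyg), betaPDF_eq_zero_of_one_le ((one_le_div hg).2 hyg.le),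
      mul_zero, mul_zero, mul_zero]

theorem lintegral_eq_mul_lintegral_comp_div {c : ℝ} (hc : 0 < c) {f : ℝ → ℝ≥0∞}
    (hf : Measurable f) :
    ∫⁻ x, f x = ENNReal.ofReal c⁻¹ * ∫⁻ y, f (y / c) := by
  calc ∫⁻ x, f x = ∫⁻ x, f (c * x / c) := by simp_rw [mul_div_cancel_left₀ _ hc.ne']
    _ = ∫⁻ y, f (y / c) ∂(volume.map (c * ·)) :=
      (lintegral_map (hf.comp (measurable_id.div_const c)) (measurable_const_mul c)).symm
    _ = ENNReal.ofReal c⁻¹ * ∫⁻ y, f (y / c) := by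
      rw [Real.map_volume_mul_left hc.ne', abs_of_pos (inv_pos.2 hc), lintegral_smul_measure,
        smul_eq_mul]

theorem gammaPDF_mul_lintegral_betaMeasure (ha : 0 < a) (hb : 0 < b) (hr : 0 < r) {g : ℝ}
    (hg : g ≠ 0) {f : ℝ × ℝ → ℝ≥0∞} (hf : Measurable f) :
    gammaPDF (a + b) r g * ∫⁻ x, f (g * x, g * (1 - x)) ∂(betaMeasure a b) =
      ∫⁻ y, gammaPDF a r y * gammaPDF b r (g - y) * f (y, g - y) := by
  have hf' : Measurable fun x => f (g * x, g * (1 - x)) := hf.comp (by fun_prop)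
  have h_ne : ∀ᵐ y : ℝ, y ≠ 0 ∧ y ≠ g := (Measure.ae_ne volume 0).and (Measure.ae_ne volume g)
  have h_density : ∀ᵐ y : ℝ, gammaPDF (a + b) r g * (ENNReal.ofReal g⁻¹ *
      (betaPDF a b (y / g) * f (g * (y / g), g * (1 - y / g)))) =
        gammaPDF a r y * gammaPDF b r (g - y) * f (y, g - y) := by
    filter_upwards [h_ne] with y ⟨hy, hyg⟩
    rw [← gammaPDF_mul_betaPDF_div ha hb hr hy hyg, mul_one_sub, mul_div_cancel₀ _ hg]
    ring
  rw [← lintegral_congr_ae h_density, betaMeasure, lintegral_withDensity_eq_lintegral_mul _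
    (measurable_betaPDF a b) hf']
  have h_meas : Measurable fun y => betaPDF a b (y / g) * f (g * (y / g), g * (1 - y / g)) :=
    ((measurable_betaPDF a b).mul hf').comp (measurable_id.div_const g)
  rw [lintegral_const_mul _ (h_meas.const_mul _), lintegral_const_mul _ h_meas]
  rcases hg.lt_or_gt with hg | hg
  · rw [gammaPDF_of_neg hg, zero_mul, zero_mul]
  · rw [lintegral_eq_mul_lintegral_comp_div hg ((measurable_betaPDF a b).mul hf')]
    rfl

theorem map_gammaMeasure_prod_betaMeasure (ha : 0 < a) (hb : 0 < b) (hr : 0 < r) :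
    ((gammaMeasure (a + b) r).prod (betaMeasure a b)).map
        (fun p => (p.1 * p.2, p.1 * (1 - p.2))) =
      (gammaMeasure a r).prod (gammaMeasure b r) := by
  have : IsProbabilityMeasure (betaMeasure a b) := isProbabilityMeasureBeta ha hb
  have : IsProbabilityMeasure (gammaMeasure b r) := isProbabilityMeasure_gammaMeasure hb hr
  refine Measure.ext_of_lintegral _ fun f hf => ?_
  have h_meas : Measurable fun p : ℝ × ℝ => f (p.1 * p.2, p.1 * (1 - p.2)) :=
    hf.comp (by fun_prop)
  calc ∫⁻ p, f p ∂_
      = ∫⁻ g, ∫⁻ x, f (g * x, g * (1 - x)) ∂(betaMeasure a b) ∂(gammaMeasure (a + b) r) := by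
        rw [lintegral_map hf (by fun_prop), lintegral_prod _ h_meas.aemeasurable]
    _ = ∫⁻ g, gammaPDF (a + b) r g * ∫⁻ x, f (g * x, g * (1 - x)) ∂(betaMeasure a b) :=
        lintegral_withDensity_eq_lintegral_mul _ (measurable_gammaPDF _ r)
          h_meas.lintegral_prod_right'
    _ = ∫⁻ g, ∫⁻ y, gammaPDF a r y * gammaPDF b r (g - y) * f (y, g - y) :=
        lintegral_congr_ae <| (Measure.ae_ne volume 0).mono fun g hg =>
          gammaPDF_mul_lintegral_betaMeasure ha hb hr hg hf
    _ = ∫⁻ y, ∫⁻ g, gammaPDF a r y * gammaPDF b r (g - y) * f (y, g - y) :=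
        lintegral_lintegral_swap (by fun_prop)
    _ = ∫⁻ y, ∫⁻ z, gammaPDF a r y * gammaPDF b r z * f (y, z) :=
        lintegral_congr fun y =>
          lintegral_sub_right_eq_self (fun z => gammaPDF a r y * gammaPDF b r z * f (y, z)) y
    _ = ∫⁻ y, gammaPDF a r y * ∫⁻ z, f (y, z) ∂(gammaMeasure b r) := by
        refine lintegral_congr fun y => ?_
        rw [gammaMeasure, lintegral_withDensity_eq_lintegral_mul _ (measurable_gammaPDF b r)
            (by fun_prop),
          ← lintegral_const_mul _ (by fun_prop)]
        simp only [mul_assoc, Pi.mul_apply]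
    _ = ∫⁻ p, f p ∂(gammaMeasure a r).prod (gammaMeasure b r) := by
        rw [lintegral_prod _ hf.aemeasurable]
        exact (lintegral_withDensity_eq_lintegral_mul _ (measurable_gammaPDF a r)
          hf.lintegral_prod_right').symm

theorem gammaMeasure_conv_gammaMeasure (ha : 0 < a) (hb : 0 < b) (hr : 0 < r) :
    gammaMeasure a r ∗ gammaMeasure b r = gammaMeasure (a + b) r := by
  have : IsProbabilityMeasure (betaMeasure a b) := isProbabilityMeasureBeta ha hb
  rw [Measure.conv, ← map_gammaMeasure_prod_betaMeasure ha hb hr,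
    Measure.map_map (by fun_prop) (by fun_prop)]
  have h_fst : (fun p : ℝ × ℝ => p.1 + p.2) ∘ (fun p => (p.1 * p.2, p.1 * (1 - p.2))) =
      Prod.fst := by
    ext p; simp only [Function.comp_apply]; ring
  rw [h_fst, Measure.map_fst_prod, measure_univ, one_smul]

theorem hasLaw_sum_gammaMeasure {Ω ι : Type*} [MeasurableSpace Ω] {P : Measure Ω} {X : ι → Ω → ℝ}
    {c : ι → ℝ} (hr : 0 < r) (hc : ∀ i, 0 < c i) (hX : ∀ i, Measurable (X i))
    (h_law : ∀ i, HasLaw (X i) (gammaMeasure (c i) r) P) (h_indep : iIndepFun X P) {s : Finset ι}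
    (hs : s.Nonempty) :
    HasLaw (fun ω => ∑ i ∈ s, X i ω) (gammaMeasure (∑ i ∈ s, c i) r) P := by
  classical
  induction hs using Finset.Nonempty.cons_induction with
  | singleton i => simpa only [Finset.sum_singleton] using h_law i
  | cons i s hi hs ih =>
    have := fun i => isProbabilityMeasure_gammaMeasure (hc i) hr
    have hc_sum : 0 < ∑ j ∈ s, c j := Finset.sum_pos (fun j _ => hc j) hs
    have := isProbabilityMeasure_gammaMeasure hc_sum hr
    have h_indep' : IndepFun (X i) (fun ω => ∑ j ∈ s, X j ω) P := by
      simpa only [Finset.sum_fn] using (h_indep.indepFun_finsetSum_of_notMem hX hi).symm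
    simp only [Finset.sum_cons]
    rw [← gammaMeasure_conv_gammaMeasure (hc i) hc_sum hr]
    exact h_indep'.hasLaw_add (h_law i) ih

end Gamma

section Unif

variable {a r : ℝ}

theorem lintegral_unif (f : ℝ → ℝ≥0∞) : ∫⁻ v, f v ∂unif = ∫⁻ v in Ioo 0 1, f v := by
  rw [unif, Measure.restrict_congr_set Ioo_ae_eq_Icc]

theorem beta_one_left (ha : 0 < a) : beta 1 a = a⁻¹ := by
  rw [beta, add_comm, Gamma_add_one ha.ne', Gamma_one, one_mul]
  field_simp [(Gamma_pos_of_pos ha).ne']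

theorem lintegral_betaMeasure_one_left (ha : 0 < a) {f : ℝ → ℝ≥0∞} (hf : Measurable f) :
    ∫⁻ x, f x ∂(betaMeasure 1 a) =
      ∫⁻ x in Ioo 0 1, ENNReal.ofReal (a * (1 - x) ^ (a - 1)) * f x := by
  rw [betaMeasure, lintegral_withDensity_eq_lintegral_mul _ (measurable_betaPDF 1 a) hf,
    ← lintegral_indicator measurableSet_Ioo]
  refine lintegral_congr fun x => ?_
  by_cases hx : x ∈ Ioo (0 : ℝ) 1
  · rw [indicator_of_mem hx, Pi.mul_apply, betaPDF_of_pos_lt_one hx.1 hx.2, beta_one_left ha,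
      one_div, inv_inv, sub_self, rpow_zero, mul_one]
  · rw [indicator_of_notMem hx, Pi.mul_apply, betaPDF, betaPDFReal, if_neg (by exact hx),
      ENNReal.ofReal_zero, zero_mul]

theorem map_one_sub_rpow_unif (ha : 0 < a) :
    unif.map (fun v => 1 - v ^ (1 / a)) = betaMeasure 1 a := by
  have h_root {x : ℝ} (hx : x ∈ Ioo (0 : ℝ) 1) : ((1 - x) ^ a) ^ (1 / a) = 1 - x := by
    rw [← rpow_mul (by linarith [hx.2]), mul_one_div_cancel ha.ne', rpow_one]
  have h_image : (fun x => (1 - x) ^ a) '' Ioo (0 : ℝ) 1 = Ioo 0 1 := by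
    ext v
    constructor
    · rintro ⟨x, ⟨hx₀, hx₁⟩, rfl⟩
      exact ⟨rpow_pos_of_pos (by linarith) a, rpow_lt_one (by linarith) (by linarith) ha⟩
    · rintro ⟨hv₀, hv₁⟩
      have h_pos := rpow_pos_of_pos hv₀ (1 / a)
      have h_lt := rpow_lt_one hv₀.le hv₁ (one_div_pos.2 ha)
      refine ⟨1 - v ^ (1 / a), ⟨by linarith, by linarith⟩, ?_⟩
      simp only [sub_sub_cancel]
      rw [← rpow_mul hv₀.le, one_div_mul_cancel ha.ne', rpow_one]
  have h_deriv (x : ℝ) (hx : x ∈ Ioo (0 : ℝ) 1) :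
      HasDerivWithinAt (fun x => (1 - x) ^ a) (-1 * a * (1 - x) ^ (a - 1)) (Ioo 0 1) x :=
    (((hasDerivAt_id' x).const_sub 1).rpow_const
      (Or.inl (by linarith [hx.2]))).hasDerivWithinAt
  have h_inj : InjOn (fun x : ℝ => (1 - x) ^ a) (Ioo 0 1) := fun x hx y hy hxy => by
    have := congrArg (· ^ (1 / a)) hxy
    simp only [h_root hx, h_root hy] at this
    linarith
  refine Measure.ext_of_lintegral _ fun f hf => ?_
  rw [lintegral_map hf (by fun_prop), lintegral_unif, ← h_image,
    lintegral_image_eq_lintegral_abs_deriv_mul measurableSet_Ioo h_deriv h_inj,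
    lintegral_betaMeasure_one_left ha hf]
  refine setLIntegral_congr_fun measurableSet_Ioo fun x hx => ?_
  have h_nonneg : 0 ≤ a * (1 - x) ^ (a - 1) :=
    mul_nonneg ha.le (rpow_nonneg (by linarith [hx.2]) _)
  simp only [h_root hx, sub_sub_cancel, neg_mul, one_mul, abs_neg, abs_of_nonneg h_nonneg]

theorem map_neg_log_unif : unif.map (fun v => -log v) = expMeasure 1 := by
  have : IsProbabilityMeasure (expMeasure 1) := isProbabilityMeasure_expMeasure one_pos
  have : IsProbabilityMeasure (unif.map fun v => -log v) :=
    Measure.isProbabilityMeasure_map (by fun_prop)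
  refine Measure.eq_of_cdf _ _ (StieltjesFunction.ext fun x => ?_)
  have h_preimage : (fun v => -log v) ⁻¹' Iic x ∩ Ioc 0 1 = Ioc 0 1 ∩ Ici (exp (-x)) := by
    rw [inter_comm]
    ext v
    exact and_congr_right fun ⟨hv, _⟩ => neg_le.trans (le_log_iff_exp_le hv)
  rw [cdf_eq_real, map_measureReal_apply (by fun_prop) measurableSet_Iic, unif,
    Measure.restrict_congr_set Ioc_ae_eq_Icc.symm,
    measureReal_restrict_apply (measurableSet_Iic.preimage (by fun_prop)), h_preimage,
    cdf_expMeasure_eq one_pos, one_mul]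
  split_ifs with hx
  · have h_Icc : Ioc 0 1 ∩ Ici (exp (-x)) = Icc (exp (-x)) 1 := by
      ext v
      simp only [mem_inter_iff, mem_Ioc, mem_Ici, mem_Icc]
      exact ⟨fun h => ⟨h.2, h.1.2⟩, fun h => ⟨⟨(exp_pos _).trans_le h.1, h.2⟩, h.1⟩⟩
    rw [h_Icc, volume_real_Icc_of_le (by simpa using hx)]
  · have h_empty : Ioc 0 1 ∩ Ici (exp (-x)) = ∅ := by
      have : 1 < exp (-x) := by simpa using hx
      ext v
      simp only [mem_inter_iff, mem_Ioc, mem_Ici, mem_empty_iff_false, iff_false]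
      exact fun h => (this.trans_le h.2).not_ge h.1.2
    rw [h_empty, measureReal_empty]

theorem measurePreserving_gamma_split (ha : 0 < a) (hr : 0 < r) :
    MeasurePreserving (fun p : ℝ × ℝ => (p.1 - p.1 * p.2 ^ (1 / a), p.1 * p.2 ^ (1 / a)))
      ((gammaMeasure (1 + a) r).prod unif) ((expMeasure r).prod (gammaMeasure a r)) := by
  have := isProbabilityMeasure_gammaMeasure (add_pos one_pos ha) hr
  have h_beta : MeasurePreserving (fun v : ℝ => 1 - v ^ (1 / a)) unif (betaMeasure 1 a) :=
    ⟨by fun_prop, map_one_sub_rpow_unif ha⟩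
  have : IsProbabilityMeasure (betaMeasure 1 a) := isProbabilityMeasureBeta one_pos ha
  have h_split : MeasurePreserving (fun p : ℝ × ℝ => (p.1 * p.2, p.1 * (1 - p.2)))
      ((gammaMeasure (1 + a) r).prod (betaMeasure 1 a)) ((expMeasure r).prod (gammaMeasure a r)) :=
    ⟨by fun_prop, map_gammaMeasure_prod_betaMeasure one_pos ha hr⟩
  convert h_split.comp ((MeasurePreserving.id (gammaMeasure (1 + a) r)).prod h_beta) using 1
  ext p <;> simp [mul_sub]

end Unif

section CondDistrib

variable {Ω 𝓧 𝓨 𝓔 : Type*} [MeasurableSpace Ω] [MeasurableSpace 𝓧] [MeasurableSpace 𝓔]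
  [MeasurableSpace 𝓨] [StandardBorelSpace 𝓨] [Nonempty 𝓨] {P : Measure Ω} [IsFiniteMeasure P]

theorem condDistrib_ae_eq_map_of_map_prodMk_eq {X : Ω → 𝓧} {Y : Ω → 𝓨} {ν : Measure 𝓔}
    [IsFiniteMeasure ν] {f : 𝓧 → 𝓔 → 𝓨} (hY : AEMeasurable Y P)
    (hf : Measurable fun p : 𝓧 × 𝓔 => f p.1 p.2)
    (h : P.map (fun ω => (X ω, Y ω)) = ((P.map X).prod ν).map fun p => (p.1, f p.1 p.2)) :
    condDistrib Y X P =ᵐ[P.map X] fun x => ν.map (f x) := by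
  let κ : Kernel 𝓧 𝓨 := (Kernel.id ×ₖ Kernel.const 𝓧 ν).map fun p => f p.1 p.2
  have hκ (x : 𝓧) : κ x = ν.map (f x) := by
    rw [Kernel.map_apply _ hf, Kernel.prod_apply, Kernel.id_apply, Kernel.const_apply,
      Measure.dirac_prod, Measure.map_map hf (by fun_prop)]
    rfl
  have h_compProd : P.map X ⊗ₘ κ = ((P.map X).prod ν).map fun p => (p.1, f p.1 p.2) := by
    refine Measure.ext_of_lintegral _ fun g hg => ?_
    rw [Measure.lintegral_compProd hg, lintegral_map hg (by fun_prop),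
      lintegral_prod _ (by fun_prop)]
    refine lintegral_congr fun x => ?_
    rw [hκ, lintegral_map (by fun_prop) (by fun_prop)]
  filter_upwards [condDistrib_ae_eq_of_measure_eq_compProd X hY (h.trans h_compProd.symm)]
    with x hx
  rw [hx, hκ]

end CondDistrib

theorem condDistrib_exp_add_gamma {Ω : Type*} [MeasurableSpace Ω] {P : Measure Ω}
    [IsFiniteMeasure P] {a r : ℝ} (ha : 0 < a) (hr : 0 < r) {X Z : Ω → ℝ}
    (hX : HasLaw X (expMeasure r) P) (hZ : HasLaw Z (gammaMeasure a r) P) (h : IndepFun X Z P) :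
    condDistrib X (fun ω => X ω + Z ω) P =ᵐ[P.map fun ω => X ω + Z ω]
      fun t => unif.map fun v => t - t * v ^ (1 / a) := by
  have := isProbabilityMeasure_expMeasure hr
  have := isProbabilityMeasure_gammaMeasure ha hr
  have h_sum : P.map (fun ω => X ω + Z ω) = gammaMeasure (1 + a) r := by
    rw [← gammaMeasure_conv_gammaMeasure one_pos ha hr]
    exact (h.hasLaw_add hX hZ).map_eq
  have h_pair : P.map (fun ω => (X ω, Z ω)) = (expMeasure r).prod (gammaMeasure a r) :=
    ((indepFun_iff_hasLaw_prodMk_prod hX hZ).1 h).map_eq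
  refine condDistrib_ae_eq_map_of_map_prodMk_eq hX.aemeasurable (by fun_prop) ?_
  have h_split := measurePreserving_gamma_split ha hr
  calc P.map (fun ω => (X ω + Z ω, X ω))
      = (P.map fun ω => (X ω, Z ω)).map fun q => (q.1 + q.2, q.1) :=
        (AEMeasurable.map_map_of_aemeasurable (g := fun q : ℝ × ℝ => (q.1 + q.2, q.1))
          (by fun_prop) (hX.aemeasurable.prodMk hZ.aemeasurable)).symm
    _ = ((gammaMeasure (1 + a) r).prod unif).map fun p => (p.1, p.1 - p.1 * p.2 ^ (1 / a)) := by
        rw [h_pair, ← h_split.map_eq, Measure.map_map (by fun_prop) h_split.measurable]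
        congr 1
        ext p <;> simp
    _ = _ := by rw [h_sum]

section OriginalSampling

theorem measurePreserving_origE (n : ℕ) :
    MeasurePreserving origE (iidUnif n) (Measure.pi fun _ => expMeasure 1) := by
  have := isProbabilityMeasure_expMeasure one_pos
  exact measurePreserving_pi _ _ fun _ => ⟨by fun_prop, map_neg_log_unif⟩

variable {n : ℕ}

theorem measurable_origE (s : Fin n) : Measurable fun u => origE u s :=
  (measurable_pi_apply s).comp (measurePreserving_origE n).measurable

theorem hasLaw_origE (s : Fin n) : HasLaw (fun u => origE u s) (expMeasure 1) (iidUnif n) := by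
  have := isProbabilityMeasure_expMeasure one_pos
  exact ((measurePreserving_eval _ s).comp (measurePreserving_origE n)).hasLaw

theorem iIndepFun_origE : iIndepFun (fun (s : Fin n) u => origE u s) (iidUnif n) :=
  iIndepFun_pi (X := fun _ v => -log v) fun _ => by fun_prop

theorem hasLaw_sum_origE {A : Finset (Fin n)} (hA : A.Nonempty) :
    HasLaw (fun u => ∑ s ∈ A, origE u s) (gammaMeasure A.card 1) (iidUnif n) := by
  simpa using hasLaw_sum_gammaMeasure one_pos (fun _ => one_pos) measurable_origE hasLaw_origE
    iIndepFun_origE hA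

theorem map_sum_origE (hn : 1 ≤ n) :
    (iidUnif n).map (fun u => ∑ s, origE u s) = gammaMeasure n 1 := by
  have : NeZero n := ⟨by omega⟩
  simpa using (hasLaw_sum_origE (n := n) Finset.univ_nonempty).map_eq

theorem condDistrib_origE (s : Fin n) (hs : (s : ℕ) + 1 < n) :
    condDistrib (fun u => origE u s) (fun u => ∑ t ∈ Finset.Ici s, origE u t) (iidUnif n)
      =ᵐ[(iidUnif n).map fun u => ∑ t ∈ Finset.Ici s, origE u t]
        fun r => unif.map (invDraw n (s + 1) r) := by
  have h_card : ((Finset.Ioi s).card : ℝ) = n - (s + 1 : ℕ) := by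
    rw [Fin.card_Ioi, Nat.sub_sub, add_comm 1, Nat.cast_sub hs.le]
  have h_pos : (0 : ℝ) < n - (s + 1 : ℕ) := sub_pos.2 (by exact_mod_cast hs)
  have h_nonempty : (Finset.Ioi s).Nonempty :=
    Finset.card_pos.1 (by exact_mod_cast h_card ▸ h_pos)
  have h_law := hasLaw_sum_origE h_nonempty
  rw [h_card] at h_law
  have h_indep : IndepFun (fun u => origE u s) (fun u => ∑ t ∈ Finset.Ioi s, origE u t)
      (iidUnif n) := by
    simpa only [Finset.sum_fn] using (iIndepFun_origE.indepFun_finsetSum_of_notMem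
      measurable_origE (s := Finset.Ioi s) (i := s) (by simp)).symm
  simp_rw [← Finset.Ioi_insert s, Finset.sum_insert (Finset.notMem_Ioi_self)]
  exact condDistrib_exp_add_gamma h_pos one_pos (hasLaw_origE s) h_law h_indep

end OriginalSampling

section IterativeSampling

variable {n m : ℕ}

theorem sum_range_iterDraw (T : ℝ) (v : Fin (n - 1) → ℝ) (k : ℕ) :
    ∑ j ∈ Finset.range k, iterDraw n v j (iterRem n T v j) = T - iterRem n T v k := by
  induction k with
  | zero => simp [iterRem]
  | succ k ih => rw [Finset.sum_range_succ, ih, iterRem]; ring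

theorem sum_iterE (hn : 1 ≤ n) (p : ℝ × (Fin (n - 1) → ℝ)) : ∑ s, iterE (n := n) p s = p.1 := by
  obtain ⟨m, rfl⟩ : ∃ m, n = m + 1 := ⟨n - 1, by omega⟩
  have h_last : iterRem (m + 1) p.1 p.2 (m + 1) = 0 := by simp [iterRem, iterDraw]
  calc ∑ s, iterE (n := m + 1) p s = p.1 - iterRem (m + 1) p.1 p.2 (m + 1) := by
        rw [← sum_range_iterDraw, ← Fin.sum_univ_eq_sum_range
          fun j => iterDraw (m + 1) p.2 j (iterRem (m + 1) p.1 p.2 j)]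
        rfl
    _ = p.1 := by rw [h_last, sub_zero]

theorem measurable_iterDraw (n k : ℕ) :
    Measurable fun q : ℝ × (Fin (n - 1) → ℝ) => iterDraw n q.2 k q.1 := by
  unfold iterDraw invDraw
  split_ifs <;> fun_prop

theorem measurable_iterRem (n k : ℕ) :
    Measurable fun p : ℝ × (Fin (n - 1) → ℝ) => iterRem n p.1 p.2 k := by
  induction k with
  | zero => exact measurable_fst
  | succ k ih => exact ih.sub ((measurable_iterDraw n k).comp (ih.prodMk measurable_snd))

theorem measurable_iterE : Measurable (iterE (n := n)) :=
  measurable_pi_iff.2 fun s =>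
    (measurable_iterDraw n s).comp ((measurable_iterRem n s).prodMk measurable_snd)

theorem iterDraw_add_two_zero (v : Fin (m + 1) → ℝ) (r : ℝ) :
    iterDraw (m + 2) v 0 r = r - r * v 0 ^ (1 / ((m + 1 : ℕ) : ℝ)) := by
  have h_exponent : ((m + 2 : ℕ) : ℝ) - ((0 + 1 : ℕ) : ℝ) = (m + 1 : ℕ) := by push_cast; ring
  rw [iterDraw, dif_pos (by simp), invDraw, h_exponent]
  rfl

theorem iterDraw_add_two_succ (v : Fin (m + 1) → ℝ) (k : ℕ) (r : ℝ) :
    iterDraw (m + 2) v (k + 1) r = iterDraw (m + 1) (Fin.tail v) k r := by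
  have h_exponent : ((m + 2 : ℕ) : ℝ) - ((k + 1 + 1 : ℕ) : ℝ) = (m + 1 : ℕ) - (k + 1 : ℕ) := by
    push_cast; ring
  by_cases hk : k < m
  · rw [iterDraw, dif_pos (by omega), iterDraw, dif_pos (by omega), invDraw, invDraw, h_exponent]
    rfl
  · rw [iterDraw, dif_neg (by omega), iterDraw, dif_neg (by omega)]

theorem iterRem_add_two_succ (T : ℝ) (v : Fin (m + 1) → ℝ) (k : ℕ) :
    iterRem (m + 2) T v (k + 1) =
      iterRem (m + 1) (T * v 0 ^ (1 / ((m + 1 : ℕ) : ℝ))) (Fin.tail v) k := by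
  induction k with
  | zero => rw [iterRem, iterRem, iterDraw_add_two_zero, sub_sub_cancel, iterRem]
  | succ k ih => rw [iterRem, ih, iterDraw_add_two_succ, iterRem]

theorem iterE_add_two (T : ℝ) (v : Fin (m + 1) → ℝ) :
    iterE (n := m + 2) (T, v) = Fin.cons (T - T * v 0 ^ (1 / ((m + 1 : ℕ) : ℝ)))
      (iterE (n := m + 1) (T * v 0 ^ (1 / ((m + 1 : ℕ) : ℝ)), Fin.tail v)) := by
  ext s
  cases s using Fin.cases with
  | zero => exact iterDraw_add_two_zero v T
  | succ s =>
    rw [Fin.cons_succ, iterE, Fin.val_succ, iterRem_add_two_succ, iterDraw_add_two_succ]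
    rfl

theorem measurePreserving_finCons {α : Type*} [MeasurableSpace α] (μ : Measure α) [SigmaFinite μ]
    (m : ℕ) :
    MeasurePreserving (fun p => Fin.cons p.1 p.2)
      (μ.prod (Measure.pi fun _ : Fin m => μ)) (Measure.pi fun _ : Fin (m + 1) => μ) := by
  convert (measurePreserving_piFinSuccAbove (fun _ : Fin (m + 1) => μ) 0).symm using 1
  ext p : 1
  exact (Fin.insertNth_zero' p.1 p.2).symm

theorem measurePreserving_head_tail {α : Type*} [MeasurableSpace α] (μ : Measure α)
    [SigmaFinite μ] (m : ℕ) :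
    MeasurePreserving (fun x => (x 0, Fin.tail x))
      (Measure.pi fun _ : Fin (m + 1) => μ) (μ.prod (Measure.pi fun _ : Fin m => μ)) :=
  measurePreserving_piFinSuccAbove (fun _ : Fin (m + 1) => μ) 0

theorem measurePreserving_iterE_succ (m : ℕ) {r : ℝ} (hr : 0 < r) :
    MeasurePreserving (iterE (n := m + 1))
      ((gammaMeasure ((m + 1 : ℕ) : ℝ) r).prod (iidUnif m)) (Measure.pi fun _ => expMeasure r) := by
  have := isProbabilityMeasure_expMeasure hr
  induction m with
  | zero =>
    have h_const : iterE (n := 1) = (fun x _ => x) ∘ Prod.fst := by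
      ext p s
      simp [iterE, iterDraw, iterRem]
    have h_cast : ((0 + 1 : ℕ) : ℝ) = 1 := by simp
    rw [h_const, h_cast]
    exact (measurePreserving_piUnique fun _ : Fin 1 => expMeasure r).symm.comp
      measurePreserving_fst
  | succ m ih =>
    have h_pos : (0 : ℝ) < (m + 1 : ℕ) := by positivity
    have h_cast : ((m + 1 + 1 : ℕ) : ℝ) = 1 + (m + 1 : ℕ) := by push_cast; ring
    have := isProbabilityMeasure_gammaMeasure h_pos hr
    have := isProbabilityMeasure_gammaMeasure (add_pos one_pos h_pos) hr
    have h_uniforms := (MeasurePreserving.id (gammaMeasure (1 + (m + 1 : ℕ)) r)).prod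
      (measurePreserving_head_tail unif m)
    have h_split := (measurePreserving_gamma_split h_pos hr).prod (.id (iidUnif m))
    have h_assoc {μ ν : Measure ℝ} [SFinite μ] [SFinite ν] :=
      measurePreserving_prodAssoc μ ν (iidUnif m)
    have h_fun : iterE (n := m + 2) = fun p : ℝ × (Fin (m + 1) → ℝ) =>
        Fin.cons (p.1 - p.1 * p.2 0 ^ (1 / ((m + 1 : ℕ) : ℝ)))
          (iterE (n := m + 1) (p.1 * p.2 0 ^ (1 / ((m + 1 : ℕ) : ℝ)), Fin.tail p.2)) :=
      funext fun p => iterE_add_two p.1 p.2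
    rw [h_cast, h_fun]
    exact (measurePreserving_finCons (expMeasure r) (m + 1)).comp <|
      ((MeasurePreserving.id (expMeasure r)).prod ih).comp <| h_assoc.comp <| h_split.comp <|
        h_assoc.symm.comp h_uniforms

theorem measurePreserving_iterE (hn : 1 ≤ n) :
    MeasurePreserving (iterE (n := n)) (iterSource n) (Measure.pi fun _ => expMeasure 1) := by
  obtain ⟨m, rfl⟩ : ∃ m, n = m + 1 := ⟨n - 1, by omega⟩
  exact measurePreserving_iterE_succ m one_pos

theorem map_iterE (hn : 1 ≤ n) :
    (iterSource n).map (iterE (n := n)) = (iidUnif n).map origE :=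
  (measurePreserving_iterE hn).map_eq.trans (measurePreserving_origE n).map_eq.symm

/-- The vector `x / ∑ x`, which turns independent exponentials into a Dirichlet vector. -/
def normalize (x : Fin n → ℝ) (s : Fin n) : ℝ := x s / ∑ t, x t

@[fun_prop]
theorem measurable_normalize : Measurable (normalize (n := n)) := by
  unfold normalize; fun_prop

@[fun_prop]
theorem measurable_copula : Measurable (copula (n := n)) := by
  unfold copula; fun_prop

theorem normalize_origE (u : Fin n → ℝ) : normalize (origE u) = origDir u := by
  ext s
  simp only [normalize, origE, origDir, Finset.sum_neg_distrib, neg_div_neg_eq]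

theorem normalize_iterE (hn : 1 ≤ n) (p : ℝ × (Fin (n - 1) → ℝ)) :
    normalize (iterE p) = iterDir (n := n) p := by
  ext s
  rw [normalize, sum_iterE hn, iterDir]

theorem map_comp_iterDir {α : Type*} [MeasurableSpace α] (hn : 1 ≤ n) {f : (Fin n → ℝ) → α}
    (hf : Measurable f) :
    (iterSource n).map (fun p => f (iterDir p)) = (iidUnif n).map fun u => f (origDir u) := by
  simp_rw [← normalize_iterE hn, ← normalize_origE]
  have hf' : Measurable fun x => f (normalize x) := by fun_prop
  exact (Measure.map_map hf' measurable_iterE).symm.trans <|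
    (congrArg _ (map_iterE hn)).trans <| Measure.map_map hf' (measurePreserving_origE n).measurable

end IterativeSampling

section Simulation

variable {X Y Z A B C Ω Ω' : Type*} [MeasurableSpace X] [MeasurableSpace Y] [MeasurableSpace Z]
  [MeasurableSpace Ω] [MeasurableSpace Ω'] {R : X → A → Prop} {R' : Y → B → Prop}
  {R'' : Z → C → Prop} {μ : Measure Ω} {μ' : Measure Ω'}

/-- The kernel `κ` refines the function `F` driven by noise of law `μ`: whenever `x` represents `a`
(in the sense of `R`), a transition of `κ` from `x` can be realised by a measurable function of
noise `ω` whose value represents `F a ω` (in the sense of `R'`). The abstract states `a` carry no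
measurable structure, and the realisation may depend on `x` but not on `a`. -/
def Simulates (R : X → A → Prop) (R' : Y → B → Prop) (κ : Kernel X Y) (μ : Measure Ω)
    (F : A → Ω → B) : Prop :=
  ∃ G : X → Ω → Y, Measurable (Function.uncurry G) ∧
    ∀ x a, R x a → κ x = μ.map (G x) ∧ ∀ ω, R' (G x ω) (F a ω)

namespace Simulates

variable {κ : Kernel X Y} {κ' : Kernel Y Z} {F : A → Ω → B} {F' : B → Ω' → C}

theorem map_eq {V : Type*} [MeasurableSpace V] (h : Simulates R R' κ μ F) {f : Y → V}
    (hf : Measurable f) {g : B → V} (hfg : ∀ y b, R' y b → f y = g b) {x : X} {a : A}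
    (ha : R x a) : (κ x).map f = μ.map fun ω => g (F a ω) := by
  obtain ⟨G, hG, hR⟩ := h
  obtain ⟨h_law, h_rel⟩ := hR x a ha
  rw [h_law, Measure.map_map hf hG.of_uncurry_left]
  exact congrArg (μ.map ·) (funext fun ω => hfg _ _ (h_rel ω))

theorem congr {F₁ : A → Ω → B} (h : Simulates R R' κ μ F)
    (hF : ∀ x a, R x a → ∀ ω, F a ω = F₁ a ω) : Simulates R R' κ μ F₁ := by
  obtain ⟨G, hG, hR⟩ := h
  exact ⟨G, hG, fun x a ha => ⟨(hR x a ha).1, fun ω => hF x a ha ω ▸ (hR x a ha).2 ω⟩⟩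

theorem comp [SFinite μ] [SFinite μ'] (h : Simulates R R' κ μ F) (h' : Simulates R' R'' κ' μ' F') :
    Simulates R R'' (κ' ∘ₖ κ) (μ.prod μ') fun a ω => F' (F a ω.1) ω.2 := by
  obtain ⟨G, hG, hR⟩ := h
  obtain ⟨G', hG', hR'⟩ := h'
  refine ⟨fun x ω => G' (G x ω.1) ω.2, ?_, fun x a ha => ⟨?_, fun ω =>
    (hR' _ _ ((hR x a ha).2 ω.1)).2 ω.2⟩⟩
  · exact hG'.comp ((hG.comp (by fun_prop : Measurable fun q : X × Ω × Ω' => (q.1, q.2.1))).prodMk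
      measurable_snd.snd)
  · have h_comp : Measurable fun ω : Ω × Ω' => G' (G x ω.1) ω.2 :=
      hG'.comp ((hG.of_uncurry_left.comp measurable_fst).prodMk measurable_snd)
    ext s hs
    rw [Kernel.comp_apply' _ _ _ hs, (hR x a ha).1,
      lintegral_map (κ'.measurable_coe hs) hG.of_uncurry_left, Measure.map_apply h_comp hs,
      Measure.prod_apply (h_comp hs)]
    refine lintegral_congr fun ω => ?_
    rw [(hR' _ _ ((hR x a ha).2 ω)).1, Measure.map_apply hG'.of_uncurry_left hs]
    rfl

theorem comp_measurePreserving (h : Simulates R R' κ μ F) {φ : Ω' → Ω}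
    (hφ : MeasurePreserving φ μ' μ) : Simulates R R' κ μ' fun a ω => F a (φ ω) := by
  obtain ⟨G, hG, hR⟩ := h
  refine ⟨fun x ω => G x (φ ω), ?_, fun x a ha => ⟨?_, fun ω => (hR x a ha).2 (φ ω)⟩⟩
  · exact hG.comp (measurable_fst.prodMk (hφ.measurable.comp measurable_snd))
  · rw [(hR x a ha).1, ← hφ.map_eq,
      Measure.map_map hG.of_uncurry_left hφ.measurable]
    rfl

theorem comp_const [IsProbabilityMeasure μ] {f : B → C} (h : Simulates R R' κ μ F)
    (h' : Simulates R' R'' κ' (Measure.dirac ()) fun b _ => f b) :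
    Simulates R R'' (κ' ∘ₖ κ) μ fun a ω => f (F a ω) :=
  (h.comp h').comp_measurePreserving (φ := fun ω => (ω, ()))
    ⟨by fun_prop, (Measure.prod_dirac _).symm⟩

theorem const_comp [IsProbabilityMeasure μ'] {f : A → B}
    (h : Simulates R R' κ (Measure.dirac ()) fun a _ => f a) (h' : Simulates R' R'' κ' μ' F') :
    Simulates R R'' (κ' ∘ₖ κ) μ' fun a ω => F' (f a) ω :=
  (h.comp h').comp_measurePreserving (φ := fun ω => ((), ω))
    ⟨by fun_prop, (Measure.dirac_prod _).symm⟩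

theorem const_measure [IsProbabilityMeasure μ] {f : A → B}
    (h : Simulates R R' κ (Measure.dirac ()) fun a _ => f a) :
    Simulates R R' κ μ fun a _ => f a :=
  h.comp_measurePreserving (φ := fun _ : Ω => ()) ⟨measurable_const, by simp [Measure.map_const]⟩

theorem of_apply_eq_dirac {g : X → Y} (hg : Measurable g) {f : A → B}
    (hκ : ∀ x, κ x = Measure.dirac (g x)) (hR : ∀ x a, R x a → R' (g x) (f a)) :
    Simulates R R' κ (Measure.dirac ()) fun a _ => f a :=
  ⟨fun x _ => g x, hg.comp measurable_fst, fun x a ha =>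
    ⟨by simp [hκ], fun _ => hR x a ha⟩⟩

theorem id {R : X → A → Prop} : Simulates R R Kernel.id (Measure.dirac ()) fun a _ => a :=
  of_apply_eq_dirac measurable_id Kernel.id_apply fun _ _ ha => ha

theorem piecewise {κ₁ κ₂ : Kernel X Y} {s : Set X} (hs : MeasurableSet s)
    [DecidablePred (· ∈ s)]
    (h₁ : Simulates (fun x a => R x a ∧ x ∈ s) R' κ₁ μ F)
    (h₂ : Simulates (fun x a => R x a ∧ x ∉ s) R' κ₂ μ F) :
    Simulates R R' (Kernel.piecewise hs κ₁ κ₂) μ F := by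
  obtain ⟨G₁, hG₁, hR₁⟩ := h₁
  obtain ⟨G₂, hG₂, hR₂⟩ := h₂
  refine ⟨fun x ω => if x ∈ s then G₁ x ω else G₂ x ω,
    Measurable.ite (measurable_fst hs) hG₁ hG₂, fun x a ha => ?_⟩
  rw [Kernel.piecewise_apply]
  by_cases hx : x ∈ s
  · simpa only [if_pos hx] using hR₁ x a ⟨ha, hx⟩
  · simpa only [if_neg hx] using hR₂ x a ⟨ha, hx⟩

end Simulates

end Simulation

namespace Cmd

section Plain

variable {ι : Type} {d : ℕ} [DecidableEq ι] (J : (Fin d → Bool) → ℝ)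

open Classical in
/-- The state transformation computed by a command without sampling and loops; sampling commands
and loops, which do not compute a function, are sent to the identity. -/
def exec : Cmd ι d → (ι → ℝ) → ι → ℝ
  | assign x e, σ => Function.update σ x (e.eval σ)
  | query x z, σ => Function.update σ x (J (bits z σ))
  | seq c₁ c₂, σ => c₂.exec (c₁.exec σ)
  | ite a b c₁ c₂, σ => if a.eval σ ≤ b.eval σ then c₁.exec σ else c₂.exec σ
  | _, σ => σ

/-- The command neither samples nor loops, so that it acts on states as the function `exec`. -/
def IsPlain {ι : Type} {d : ℕ} : Cmd ι d → Prop
  | seq c₁ c₂ => c₁.IsPlain ∧ c₂.IsPlain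
  | ite _ _ c₁ c₂ => c₁.IsPlain ∧ c₂.IsPlain
  | skip | assign _ _ | query _ _ => True
  | uniform _ | gamma _ _ | loop _ _ _ => False

variable {J}

theorem exec_skip (σ : ι → ℝ) : (skip : Cmd ι d).exec J σ = σ := rfl

theorem exec_seq (c₁ c₂ : Cmd ι d) (σ : ι → ℝ) :
    (seq c₁ c₂).exec J σ = c₂.exec J (c₁.exec J σ) := rfl

theorem IsPlain.run_apply {c : Cmd ι d} (hc : c.IsPlain) (σ : ι → ℝ) :
    c.run J σ = Measure.dirac (c.exec J σ) := by
  induction c generalizing σ with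
  | skip => exact Kernel.id_apply σ
  | assign | query => rw [run, storeFun, Kernel.deterministic_apply, exec]
  | seq c₁ c₂ ih₁ ih₂ =>
    rw [run, Kernel.comp_apply, ih₁ hc.1, Measure.dirac_bind (Kernel.measurable _), ih₂ hc.2, exec]
  | ite a b c₁ c₂ ih₁ ih₂ =>
    rw [run, Kernel.piecewise_apply, exec, ih₁ hc.1, ih₂ hc.2, apply_ite Measure.dirac]
    rfl
  | uniform | gamma | loop => exact hc.elim

theorem IsPlain.measurable_exec {c : Cmd ι d} (hc : c.IsPlain) : Measurable (c.exec J) := by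
  intro s hs
  have h_preimage : c.exec J ⁻¹' s = (fun σ => c.run J σ s) ⁻¹' {1} := by
    ext σ
    by_cases hσ : c.exec J σ ∈ s <;> simp [hc.run_apply, Measure.dirac_apply' _ hs, hσ]
  exact h_preimage ▸ (c.run J).measurable_coe hs (measurableSet_singleton 1)

end Plain

end Cmd

section SimulationOfCommands

variable {ι : Type} [DecidableEq ι] {d : ℕ} {J : (Fin d → Bool) → ℝ} {A B : Type*}
  {R : (ι → ℝ) → A → Prop} {R' : (ι → ℝ) → B → Prop}

theorem simulates_of_isPlain {c : Cmd ι d} (hc : c.IsPlain) {f : A → B}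
    (hR : ∀ σ a, R σ a → R' (c.exec J σ) (f a)) :
    Simulates R R' (c.run J) (Measure.dirac ()) fun a _ => f a :=
  .of_apply_eq_dirac hc.measurable_exec hc.run_apply hR

theorem storeKernel_apply (x : ι) (κ : Kernel (ι → ℝ) ℝ) [IsSFiniteKernel κ] (σ : ι → ℝ) :
    storeKernel x κ σ = (κ σ).map (Function.update σ x) := by
  have h_update : Measurable fun p : (ι → ℝ) × ℝ => Function.update p.1 x p.2 :=
    measurable_update'
  rw [storeKernel, Kernel.map_apply _ h_update, Kernel.prod_apply, Kernel.id_apply,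
    Measure.dirac_prod, Measure.map_map h_update measurable_prodMk_left]
  rfl

theorem simulates_storeKernel {x : ι} {κ : Kernel (ι → ℝ) ℝ} [IsSFiniteKernel κ] {μ : Measure ℝ}
    (hκ : ∀ σ a, R σ a → κ σ = μ) {F : A → ℝ → B}
    (hR : ∀ σ a, R σ a → ∀ t, R' (Function.update σ x t) (F a t)) :
    Simulates R R' (storeKernel x κ) μ F :=
  ⟨fun σ => Function.update σ x, measurable_update', fun σ a ha =>
    ⟨by rw [storeKernel_apply, hκ σ a ha], hR σ a ha⟩⟩

theorem simulates_uniform {x : ι} {F : A → ℝ → B}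
    (hR : ∀ σ a, R σ a → ∀ u, R' (Function.update σ x u) (F a u)) :
    Simulates R R' ((Cmd.uniform x : Cmd ι d).run J) unif F :=
  simulates_storeKernel (fun σ _ _ => Kernel.const_apply unif σ) hR

theorem simulates_gamma {x b : ι} {n : ℕ} (hb : ∀ σ a, R σ a → σ b = n) {F : A → ℝ → B}
    (hR : ∀ σ a, R σ a → ∀ t, R' (Function.update σ x t) (F a t)) :
    Simulates R R' ((Cmd.gamma x b : Cmd ι d).run J) (gammaNat n) F := by
  refine simulates_storeKernel (κ := gammaKernel b) (fun σ a ha => ?_) hR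
  change gammaNat ⌊σ b⌋₊ = _
  rw [hb σ a ha, Nat.floor_natCast]

theorem simulates_ite {Ω : Type*} [MeasurableSpace Ω] {μ : Measure Ω} {a b : Expr ι}
    {c₁ c₂ : Cmd ι d} {F : A → Ω → B}
    (h₁ : Simulates (fun σ x => R σ x ∧ a.eval σ ≤ b.eval σ) R' (c₁.run J) μ F)
    (h₂ : Simulates (fun σ x => R σ x ∧ ¬a.eval σ ≤ b.eval σ) R' (c₂.run J) μ F) :
    Simulates R R' ((Cmd.ite a b c₁ c₂).run J) μ F :=
  .piecewise _ h₁ h₂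

end SimulationOfCommands

section SimulationOfLoops

variable {ι V W Ω : Type*} [MeasurableSpace Ω] {μ : Measure Ω}

theorem extend_fin_succ {d m : ℕ} {e : Fin (m + 1) → Fin d} (he : Function.Injective e)
    (f : Fin (m + 1) → V) (g : Fin d → V) :
    Function.extend (fun k : Fin m => e k.succ) (fun k => f k.succ)
      (Function.update g (e 0) (f 0)) = Function.extend e f g := by
  have he_succ : Function.Injective fun k : Fin m => e k.succ := he.comp (Fin.succ_injective m)
  funext i
  by_cases hi : ∃ k, e k = i
  · obtain ⟨k, rfl⟩ := hi
    rw [he.extend_apply]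
    cases k using Fin.cases with
    | zero =>
      rw [Function.extend_apply' _ _ _ fun ⟨k, hk⟩ => Fin.succ_ne_zero k (he hk),
        Function.update_self]
    | succ k => exact he_succ.extend_apply (fun k => f k.succ) _ k
  · rw [Function.extend_apply' _ _ _ hi,
      Function.extend_apply' _ _ _ fun ⟨k, hk⟩ => hi ⟨k.succ, hk⟩,
      Function.update_of_ne fun h => hi ⟨0, h.symm⟩]

theorem simulates_block_ofFn [IsProbabilityMeasure μ] {ι : Type} [DecidableEq ι] {d : ℕ}
    {J : (Fin d → Bool) → ℝ} {R : (ι → ℝ) → (Fin d → V) × W → Prop} {c : Fin d → Cmd ι d}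
    {h : W → Fin d → V → Ω → V}
    (hc : ∀ i, Simulates R R ((c i).run J) μ fun a ω =>
      (Function.update a.1 i (h a.2 i (a.1 i) ω), a.2))
    {m : ℕ} {e : Fin m → Fin d} (he : Function.Injective e) :
    Simulates R R ((Cmd.block (List.ofFn fun k => c (e k))).run J) (Measure.pi fun _ => μ)
      fun a ω => (Function.extend e (fun k => h a.2 (e k) (a.1 (e k)) (ω k)) a.1, a.2) := by
  induction m with
  | zero =>
    refine Simulates.id.const_measure.congr fun _ a _ ω => Prod.ext (funext fun i => ?_) rfl
    simp only [Function.extend_apply' _ _ _ fun h : ∃ k, e k = i => Fin.elim0 h.choose]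
  | succ m ih =>
    have h_tail := ih (e := fun k => e k.succ) (he.comp (Fin.succ_injective m))
    have h_block := ((hc (e 0)).comp h_tail).comp_measurePreserving
      (measurePreserving_head_tail μ m)
    rw [List.ofFn_succ]
    refine h_block.congr fun _ a _ ω => Prod.ext ?_ rfl
    rw [← extend_fin_succ he]
    simp [Fin.tail, he.ne (Fin.succ_ne_zero _)]

theorem simulates_forDim [IsProbabilityMeasure μ] {ι : Type} [DecidableEq ι] {d : ℕ}
    {J : (Fin d → Bool) → ℝ} {R : (ι → ℝ) → (Fin d → V) × W → Prop} {c : Fin d → Cmd ι d}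
    {h : W → Fin d → V → Ω → V}
    (hc : ∀ i, Simulates R R ((c i).run J) μ fun a ω =>
      (Function.update a.1 i (h a.2 i (a.1 i) ω), a.2)) :
    Simulates R R ((Cmd.forDim c).run J) (Measure.pi fun _ => μ)
      fun a ω => (fun i => h a.2 i (a.1 i) (ω i), a.2) := by
  have h_block := simulates_block_ofFn hc Function.injective_id
  rw [List.ofFn_eq_map] at h_block
  exact h_block.congr fun _ a _ ω =>
    Prod.ext (funext fun i => Function.injective_id.extend_apply
      (fun i => h a.2 i (a.1 i) (ω i)) a.1 i) rfl

theorem simulates_forDim_const {ι : Type} [DecidableEq ι] {d : ℕ} {J : (Fin d → Bool) → ℝ}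
    {R : (ι → ℝ) → (Fin d → V) × W → Prop} {c : Fin d → Cmd ι d} {h : W → Fin d → V → V}
    (hc : ∀ i, Simulates R R ((c i).run J) (Measure.dirac ()) fun a _ =>
      (Function.update a.1 i (h a.2 i (a.1 i)), a.2)) :
    Simulates R R ((Cmd.forDim c).run J) (Measure.dirac ())
      fun a _ => (fun i => h a.2 i (a.1 i), a.2) :=
  (simulates_forDim (h := fun w i v _ => h w i v) hc).comp_measurePreserving
    (φ := fun _ _ => ()) ⟨measurable_const, by
      rw [Measure.map_const, measure_univ, one_smul]
      exact Measure.ext fun s _ => Subsingleton.set_cases (by simp) (by simp) s⟩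

theorem measurePreserving_init_last [SigmaFinite μ] (m : ℕ) :
    MeasurePreserving (fun x : Fin (m + 1) → Ω => (Fin.init x, x (Fin.last m)))
      (Measure.pi fun _ => μ) ((Measure.pi fun _ => μ).prod μ) := by
  have h := Measure.measurePreserving_swap.comp
    (measurePreserving_piFinSuccAbove (fun _ : Fin (m + 1) => μ) (Fin.last m))
  convert h using 1
  funext x
  simp [MeasurableEquiv.piFinSuccAbove]

/-- The state after `m` rounds started from `a`, where round `k + 1` applies `F k` with the noise
`ω k`. -/
def loopState {A Ω : Type*} (F : ℕ → A → Ω → A) : (m : ℕ) → A → (Fin m → Ω) → A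
  | 0, a, _ => a
  | m + 1, a, ω => F m (loopState F m a (Fin.init ω)) (ω (Fin.last m))

variable {ι : Type} [DecidableEq ι] {A : Type*} {R : ℕ → (ι → ℝ) → A → Prop} {x : ι}
  {F : ℕ → A → Ω → A}

theorem simulates_rounds [IsProbabilityMeasure μ] {κ : Kernel (ι → ℝ) (ι → ℝ)}
    (hx : ∀ k σ a, R k σ a → R (k + 1) (Function.update σ x (k + 1 : ℕ)) a)
    (hκ : ∀ k, Simulates (R (k + 1)) (R (k + 1)) κ μ (F k)) (m : ℕ) :
    Simulates (R 0) (R m) (rounds x κ m) (Measure.pi fun _ => μ) (loopState F m) := by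
  induction m with
  | zero => exact Simulates.id.const_measure
  | succ m ih =>
    have h_counter : Simulates (R m) (R (m + 1))
        (storeFun x (fun _ => ((m + 1 : ℕ) : ℝ)) measurable_const) (Measure.dirac ())
        fun a _ => a :=
      .of_apply_eq_dirac (by fun_prop) (fun σ => Kernel.deterministic_apply _ σ) (hx m)
    rw [rounds, Kernel.comp_assoc]
    exact ((ih.comp_const h_counter).comp (hκ m)).comp_measurePreserving
      (measurePreserving_init_last m)

theorem simulates_loop [IsProbabilityMeasure μ] {d m : ℕ} {J : (Fin d → Bool) → ℝ}
    {b : ι} {c : Cmd ι d} (hb : ∀ σ a, R 0 σ a → σ b = m)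
    (hx : ∀ k σ a, R k σ a → R (k + 1) (Function.update σ x (k + 1 : ℕ)) a)
    (hc : ∀ k, Simulates (R (k + 1)) (R (k + 1)) (c.run J) μ (F k)) :
    Simulates (R 0) (R m) ((Cmd.loop x b c).run J) (Measure.pi fun _ => μ) (loopState F m) := by
  obtain ⟨G, hG, hR⟩ := simulates_rounds hx hc m
  refine ⟨G, hG, fun σ a ha => ⟨?_, (hR σ a ha).2⟩⟩
  rw [← (hR σ a ha).1]
  change rounds x (c.run J) ⌊σ b⌋₊ σ = _
  rw [hb σ a ha, Nat.floor_natCast]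

end SimulationOfLoops

section PureAlgorithm

/-- The data which the iterative algorithm keeps for one coordinate: the registers of `VecName`
without the parameter, and with the current bit as a Boolean. -/
structure Coord where
  (total rem rho accS accJS g : ℝ)
  z : Bool

/-- The data which the iterative algorithm shares between the coordinates: the value of `J` at the
current sample, and the running mean of these values. -/
structure Shared where
  (j meanJ : ℝ)

/-- The states of the iterative algorithm. -/
abbrev State (d : ℕ) : Type := (Fin d → Coord) × Shared

/-- The partial derivative of `log p_θ` at a sample with bit `b` in a coordinate with parameter
`t`. -/
def scoreCoord (t : ℝ) (b : Bool) : ℝ := if b then 1 / t else -(1 / (1 - t))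

/-- The update of an accumulator `x` with a new value `y` in round `s`. -/
def accumulate (s : ℕ) (x y : ℝ) : ℝ :=
  max ((s : ℝ) - 2) 1 / max ((s : ℝ) - 1) 1 * x + 1 / max ((s : ℝ) - 1) 1 * y

/-- The summand drawn in round `s` when the remaining sum is `r` and the fresh uniform is `u`,
which is ignored in round `n`. -/
def draw (n s : ℕ) (r u : ℝ) : ℝ := if s < n then invDraw n s r u else r

namespace Coord

/-- The contents of the vector registers of a coordinate with parameter `t`. -/
def encode (t : ℝ) (c : Coord) : VecName → ℝ
  | .theta => t
  | .total => c.total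
  | .rem => c.rem
  | .rho => c.rho
  | .z => if c.z then 1 else 0
  | .accS => c.accS
  | .accJS => c.accJS
  | .g => c.g

/-- Remove the summand `e` from the remaining sum and compute the bit it determines. -/
def split (n : ℕ) (t e : ℝ) (c : Coord) : Coord :=
  { c with rem := c.rem - e, z := armsBit t (1 - (1 - e / c.total) ^ (n - 1)) }

/-- Update the accumulators of the score and of `J` times the score in round `s`. -/
def addScore (s : ℕ) (t j : ℝ) (c : Coord) : Coord :=
  { c with
    accS := accumulate s c.accS (scoreCoord t c.z)
    accJS := accumulate s c.accJS (j * scoreCoord t c.z) }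

/-- Compute the output from the accumulators and the mean `m` of `J`. -/
def finish (m : ℝ) (c : Coord) : Coord :=
  { c with g := 1 / (1 - c.rho) * (c.accJS - c.accS * m) }

end Coord

variable {d : ℕ}

/-- The machine state `σ` stores `a` in the `k`-th round of a run with `n` samples and parameter
`θ`; the registers `u`, `e`, `dir` and `w`, which only hold temporary values, are ignored. -/
structure Represents (n : ℕ) (θ : Fin d → ℝ) (k : ℕ) (σ : Reg d → ℝ) (a : State d) : Prop where
  vec : ∀ i x, σ (V x i) = (a.1 i).encode (θ i) x
  n : σ (S .n) = n
  s : σ (S .s) = k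
  j : σ (S .j) = a.2.j
  meanJ : σ (S .meanJ) = a.2.meanJ

variable {n k : ℕ} {θ : Fin d → ℝ} {J : (Fin d → Bool) → ℝ}

theorem Represents.of_eq {σ τ : Reg d → ℝ} {a : State d} (h : Represents n θ k σ a)
    (h_vec : ∀ i x, τ (V x i) = σ (V x i))
    (h_scal : ∀ y ∈ [ScalName.n, .s, .j, .meanJ], τ (S y) = σ (S y)) : Represents n θ k τ a where
  vec i x := (h_vec i x).trans (h.vec i x)
  n := (h_scal .n (by simp)).trans h.n
  s := (h_scal .s (by simp)).trans h.s
  j := (h_scal .j (by simp)).trans h.j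
  meanJ := (h_scal .meanJ (by simp)).trans h.meanJ

theorem Represents.update_coord {σ τ : Reg d → ℝ} {a : State d} (h : Represents n θ k σ a)
    {i : Fin d} {c : Coord} (h_self : ∀ x, τ (V x i) = c.encode (θ i) x)
    (h_vec : ∀ l ≠ i, ∀ x, τ (V x l) = σ (V x l))
    (h_scal : ∀ y ∈ [ScalName.n, .s, .j, .meanJ], τ (S y) = σ (S y)) :
    Represents n θ k τ (Function.update a.1 i c, a.2) where
  vec l x := by
    by_cases hl : l = i
    · subst hl
      simp [h_self]
    · simp [h_vec l hl, h.vec, hl]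
  n := (h_scal .n (by simp)).trans h.n
  s := (h_scal .s (by simp)).trans h.s
  j := (h_scal .j (by simp)).trans h.j
  meanJ := (h_scal .meanJ (by simp)).trans h.meanJ

theorem simulates_resetMean :
    Simulates (Represents n θ k) (Represents n θ k)
      ((Cmd.assign (S .meanJ) (.const 0)).run J) (Measure.dirac ())
      fun a _ => (a.1, { a.2 with meanJ := 0 }) :=
  simulates_of_isPlain (by exact trivial) fun σ a h =>
    ⟨fun i x => by simp [Cmd.exec, h.vec], by simp [Cmd.exec, h.n], by simp [Cmd.exec, h.s],
      by simp [Cmd.exec, h.j], by simp [Cmd.exec, Expr.eval]⟩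

theorem simulates_resetAccumulators :
    Simulates (Represents n θ k) (Represents n θ k)
      ((Cmd.forDim fun i : Fin d => .seq (.assign (V .accS i) (.const 0))
        (.assign (V .accJS i) (.const 0))).run J) (Measure.dirac ())
      fun a _ => (fun i => { a.1 i with accS := 0, accJS := 0 }, a.2) := by
  refine simulates_forDim_const (h := fun _ _ (c : Coord) => { c with accS := 0, accJS := 0 })
    fun i => simulates_of_isPlain (by exact ⟨trivial, trivial⟩) fun σ a h =>
      h.update_coord (fun x => ?_) (fun l hl x => ?_) ?_
  · cases x <;> simp [Cmd.exec, Expr.eval, Coord.encode, h.vec]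
  · simp [Cmd.exec, hl]
  · simp [Cmd.exec]

theorem simulates_drawTotals :
    Simulates (Represents n θ k) (Represents n θ k)
      ((Cmd.forDim fun i : Fin d => .seq (.gamma (V .total i) (S .n))
        (.assign (V .rem i) (rv .total i))).run J) (Measure.pi fun _ => gammaNat n)
      fun a T => (fun i => { a.1 i with total := T i, rem := T i }, a.2) := by
  refine simulates_forDim (h := fun _ _ (c : Coord) t => { c with total := t, rem := t })
    fun i => ?_
  have h_total : Simulates (Represents n θ k) (Represents n θ k)
      ((Cmd.gamma (V .total i) (S .n)).run J) (gammaNat n)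
      fun a t => (Function.update a.1 i { a.1 i with total := t }, a.2) := by
    refine simulates_gamma (fun σ a h => h.n) fun σ a h t =>
      h.update_coord (fun x => ?_) (fun l hl x => ?_) ?_
    · cases x <;> simp [Coord.encode, h.vec]
    · simp [hl]
    · simp
  have h_rem : Simulates (Represents n θ k) (Represents n θ k)
      ((Cmd.assign (V .rem i) (rv .total i)).run J) (Measure.dirac ())
      fun a _ => (Function.update a.1 i { a.1 i with rem := (a.1 i).total }, a.2) := by
    refine simulates_of_isPlain (by exact trivial) fun σ a h =>
      h.update_coord (fun x => ?_) (fun l hl x => ?_) ?_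
    · cases x <;> simp [Cmd.exec, Expr.eval, Coord.encode, h.vec]
    · simp [Cmd.exec, hl]
    · simp [Cmd.exec]
  exact (h_total.comp_const h_rem).congr fun _ a _ t => by simp

theorem rpow_natCast_sub_one (hn : 1 ≤ n) (x : ℝ) : x ^ ((n : ℝ) - 1) = x ^ (n - 1) := by
  rw [← Nat.cast_pred hn, Real.rpow_natCast]

theorem simulates_setRho (hn : 1 ≤ n) :
    Simulates (Represents n θ k) (Represents n θ k)
      ((Cmd.forDim (rhoCmd (d := d))).run J) (Measure.dirac ())
      fun a _ => (fun i => { a.1 i with rho := armsRho n (θ i) }, a.2) := by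
  have h_exec (i : Fin d) {σ : Reg d → ℝ} {a : State d} (h : Represents n θ k σ a) :
      (rhoCmd i).exec J σ = Function.update σ (V .rho i) (armsRho n (θ i)) := by
    simp only [rhoCmd, Cmd.exec, Expr.eval, rhoExpr, armsRho, h.n, h.vec, Coord.encode,
      rpow_natCast_sub_one hn, sq, Nat.cast_ofNat, Nat.cast_one, Nat.cast_zero, ← not_le, ite_not]
    split_ifs <;> rfl
  refine simulates_forDim_const (h := fun _ i (c : Coord) => { c with rho := armsRho n (θ i) })
    fun i => simulates_of_isPlain (by exact ⟨trivial, trivial⟩) fun σ a h => ?_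
  rw [h_exec i h]
  refine h.update_coord (fun x => ?_) (fun l hl x => ?_) ?_
  · cases x <;> simp [Coord.encode, h.vec]
  · simp [hl]
  · simp

theorem simulates_addScore (s : ℕ) :
    Simulates (Represents n θ s) (Represents n θ s)
      ((Cmd.forDim fun i : Fin d => .seq (.assign (V .accS i) (accExpr (rv .accS i) (scoreExpr i)))
        (.assign (V .accJS i) (accExpr (rv .accJS i) (.mul (rs .j) (scoreExpr i))))).run J)
      (Measure.dirac ()) fun a _ => (fun i => (a.1 i).addScore s (θ i) a.2.j, a.2) := by
  refine simulates_forDim_const (h := fun (w : Shared) i (c : Coord) => c.addScore s (θ i) w.j)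
    fun i => simulates_of_isPlain (by exact ⟨trivial, trivial⟩) fun σ a h =>
      h.update_coord (fun x => ?_) (fun l hl x => ?_) ?_
  · have h_score : (if (a.1 i).z then (1 : ℝ) else 0) / θ i -
        (1 - if (a.1 i).z then (1 : ℝ) else 0) / (1 - θ i) = scoreCoord (θ i) (a.1 i).z := by
      cases (a.1 i).z <;> simp [scoreCoord]
    cases x <;> simp [Cmd.exec, Expr.eval, accExpr, scoreExpr, Coord.encode, Coord.addScore,
      accumulate, h.vec, h.s, h.j, ← h_score]
  · simp [Cmd.exec, hl]
  · simp [Cmd.exec]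

theorem simulates_finish :
    Simulates (Represents n θ k) (Represents n θ k)
      ((Cmd.forDim fun i : Fin d => .assign (V .g i)
        (.mul (.div (.const 1) (.sub (.const 1) (rv .rho i)))
          (.sub (rv .accJS i) (.mul (rv .accS i) (rs .meanJ))))).run J)
      (Measure.dirac ()) fun a _ => (fun i => (a.1 i).finish a.2.meanJ, a.2) := by
  refine simulates_forDim_const (h := fun (w : Shared) _ (c : Coord) => c.finish w.meanJ) fun i =>
    simulates_of_isPlain (by exact trivial) fun σ a h =>
      h.update_coord (fun x => ?_) (fun l hl x => ?_) ?_
  · cases x <;> simp [Cmd.exec, Expr.eval, Coord.encode, Coord.finish, h.vec, h.meanJ]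
  · simp [Cmd.exec, hl]
  · simp [Cmd.exec]

/-- Like `Represents`, with the summand `p.2` held by the register `e`. -/
def RepresentsDraw (n : ℕ) (θ : Fin d → ℝ) (k : ℕ) (σ : Reg d → ℝ) (p : State d × ℝ) : Prop :=
  Represents n θ k σ p.1 ∧ σ (S .e) = p.2

/-- The first command of `sampleCmd i`, which draws the summand. -/
def drawCmd (i : Fin d) : Cmd (Reg d) d :=
  .ite (rs .n) (rs .s)
    (.assign (S .e) (rv .rem i))
    (.seq (.uniform (S .u))
      (.assign (S .e) (.sub (rv .rem i) (.mul (rv .rem i)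
        (.pow (rs .u) (.div (.const 1) (.sub (rs .n) (rs .s))))))))

/-- The last command of `sampleCmd i`, which stores the bit. -/
def storeBitCmd (i : Fin d) : Cmd (Reg d) d :=
  .ite (rv .theta i) (.div (.const 1) (.const 2))
    (.ite (.sub (.const 1) (rs .w)) (rv .theta i)
      (.assign (V .z i) (.const 1)) (.assign (V .z i) (.const 0)))
    (.ite (rs .w) (rv .theta i)
      (.assign (V .z i) (.const 1)) (.assign (V .z i) (.const 0)))

theorem simulates_draw (i : Fin d) :
    Simulates (Represents n θ k) (RepresentsDraw n θ k)
      ((drawCmd i).run J) unif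
      fun a u => (a, draw n k (a.1 i).rem u) := by
  have h_le {σ : Reg d → ℝ} {a : State d} (h : Represents n θ k σ a) :
      σ (S .n) ≤ σ (S .s) ↔ ¬k < n := by
    rw [h.n, h.s, Nat.cast_le, not_lt]
  refine simulates_ite ?_ ?_
  · have h_assign : Simulates (fun σ a => Represents n θ k σ a ∧ σ (S .n) ≤ σ (S .s))
        (RepresentsDraw n θ k) ((Cmd.assign (S .e) (rv .rem i)).run J) (Measure.dirac ())
        fun a _ => (a, (a.1 i).rem) :=
      simulates_of_isPlain (by exact trivial) fun σ a h =>
        ⟨h.1.of_eq (by simp [Cmd.exec]) (by simp [Cmd.exec]),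
          by simp [Cmd.exec, Expr.eval, h.1.vec, Coord.encode]⟩
    refine h_assign.const_measure.congr fun σ a h u => ?_
    rw [draw, if_neg ((h_le h.1).1 h.2)]
  · have h_uniform : Simulates (fun σ a => Represents n θ k σ a ∧ ¬σ (S .n) ≤ σ (S .s))
        (fun σ (p : State d × ℝ) => (Represents n θ k σ p.1 ∧ ¬σ (S .n) ≤ σ (S .s)) ∧
          σ (S .u) = p.2) ((Cmd.uniform (S .u)).run J) unif fun a u => (a, u) :=
      simulates_uniform fun σ a h u =>
        ⟨⟨h.1.of_eq (by simp) (by simp), by simpa using h.2⟩, by simp⟩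
    refine h_uniform.comp_const (f := fun p : State d × ℝ => (p.1, draw n k (p.1.1 i).rem p.2))
      (simulates_of_isPlain (by exact trivial) fun σ p h =>
        ⟨h.1.1.of_eq (by simp [Cmd.exec]) (by simp [Cmd.exec]), ?_⟩)
    have h_lt : k < n := not_not.1 ((h_le h.1.1).not.1 h.1.2)
    simp [Cmd.exec, Expr.eval, h.1.1.vec, Coord.encode, h.1.1.n, h.1.1.s, h.2, draw, h_lt, invDraw]

theorem exec_storeBit (i : Fin d) (σ : Reg d → ℝ) :
    (storeBitCmd i).exec J σ =
      Function.update σ (V .z i) (if armsBit (σ (V .theta i)) (σ (S .w)) then 1 else 0) := by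
  simp only [storeBitCmd, Cmd.exec, Expr.eval, armsBit, Nat.cast_one, Nat.cast_ofNat, Nat.cast_zero,
    ← apply_ite (Function.update σ (V .z i)), gt_iff_lt, ← not_le]
  by_cases h : σ (V .theta i) ≤ 1 / 2 <;> simp only [h, not_true, not_false_iff, if_true, if_false,
    decide_eq_true_eq]

theorem simulates_split (hn : 1 ≤ n) (i : Fin d) :
    Simulates (RepresentsDraw n θ k) (Represents n θ k)
      ((Cmd.block [
        .assign (V .rem i) (.sub (rv .rem i) (rs .e)),
        .assign (S .dir) (.div (rs .e) (rv .total i)),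
        .assign (S .w)
          (.sub (.const 1) (.pow (.sub (.const 1) (rs .dir)) (.sub (rs .n) (.const 1)))),
        storeBitCmd i]).run J)
      (Measure.dirac ())
      fun p _ => (Function.update p.1.1 i ((p.1.1 i).split n (θ i) p.2), p.1.2) := by
  refine simulates_of_isPlain (by simp [Cmd.block, Cmd.IsPlain, storeBitCmd]) fun σ p h =>
    h.1.update_coord (fun x => ?_) (fun l hl x => ?_) ?_
  · simp only [Cmd.block, Cmd.exec_seq, Cmd.exec_skip, exec_storeBit]
    cases x <;> simp [Cmd.exec, Expr.eval, Coord.encode, Coord.split, h.1.vec, h.2, h.1.n,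
      rpow_natCast_sub_one hn]
    congr
  · simp only [Cmd.block, Cmd.exec_seq, Cmd.exec_skip, exec_storeBit]
    simp [Cmd.exec, hl]
  · simp only [Cmd.block, Cmd.exec_seq, Cmd.exec_skip, exec_storeBit]
    simp [Cmd.exec]

theorem simulates_sample (hn : 1 ≤ n) :
    Simulates (Represents n θ k) (Represents n θ k) ((Cmd.forDim sampleCmd).run J)
      (Measure.pi fun _ => unif) fun a u =>
        (fun i => (a.1 i).split n (θ i) (draw n k (a.1 i).rem (u i)), a.2) :=
  simulates_forDim (h := fun _ i (c : Coord) u => c.split n (θ i) (draw n k c.rem u)) fun i =>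
    (simulates_draw i).comp_const (simulates_split hn i)

theorem simulates_query :
    Simulates (Represents n θ k) (Represents n θ k) ((Cmd.query (S .j) (V .z)).run J)
      (Measure.dirac ()) fun a _ => (a.1, { a.2 with j := J fun i => (a.1 i).z }) := by
  refine simulates_of_isPlain (by exact trivial) fun σ a h => ?_
  have h_bits : bits (V .z) σ = fun i => (a.1 i).z := by
    funext i
    simp [bits, h.vec, Coord.encode]
  exact ⟨fun i x => by simp [Cmd.exec, h.vec], by simp [Cmd.exec, h.n], by simp [Cmd.exec, h.s],
    by simp [Cmd.exec, h_bits], by simp [Cmd.exec, h.meanJ]⟩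

theorem simulates_updateMean :
    Simulates (Represents n θ k) (Represents n θ k)
      ((Cmd.assign (S .meanJ) (.add
        (.mul (.div (.sub (rs .s) (.const 1)) (rs .s)) (rs .meanJ))
        (.mul (.div (.const 1) (rs .s)) (rs .j)))).run J) (Measure.dirac ())
      fun a _ => (a.1, { a.2 with meanJ := ((k : ℝ) - 1) / k * a.2.meanJ + 1 / k * a.2.j }) :=
  simulates_of_isPlain (by exact trivial) fun σ a h =>
    ⟨fun i x => by simp [Cmd.exec, h.vec], by simp [Cmd.exec, h.n], by simp [Cmd.exec, h.s],
      by simp [Cmd.exec, h.j], by simp [Cmd.exec, Expr.eval, h.s, h.j, h.meanJ]⟩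

/-- Round `s` of the iterative algorithm, with one fresh uniform for every coordinate. -/
def iterRound (n : ℕ) (J : (Fin d → Bool) → ℝ) (θ : Fin d → ℝ) (s : ℕ) (a : State d)
    (u : Fin d → ℝ) : State d :=
  let c i := (a.1 i).split n (θ i) (draw n s (a.1 i).rem (u i))
  let j := J fun i => (c i).z
  (fun i => (c i).addScore s (θ i) j, ⟨j, ((s : ℝ) - 1) / s * a.2.meanJ + 1 / s * j⟩)

theorem simulates_roundCmd (hn : 1 ≤ n) :
    Simulates (Represents n θ k) (Represents n θ k) ((roundCmd d).run J)
      (Measure.pi fun _ => unif) (iterRound n J θ k) :=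
  (simulates_sample hn).comp_const <| simulates_query.const_comp <|
    simulates_updateMean.const_comp <| (simulates_addScore k).const_comp Simulates.id

theorem simulates_mainLoop (hn : 1 ≤ n) :
    Simulates (Represents n θ 0) (Represents n θ n) ((Cmd.loop (S .s) (S .n) (roundCmd d)).run J)
      (Measure.pi fun _ => Measure.pi fun _ => unif)
      (loopState (fun k => iterRound n J θ (k + 1)) n) :=
  simulates_loop (R := Represents n θ) (fun _ _ h => h.n)
    (fun k σ a h => ⟨fun i x => by simp [h.vec], by simp [h.n], by simp, by simp [h.j],
      by simp [h.meanJ]⟩) fun _ => simulates_roundCmd hn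

/-- The state of the iterative algorithm before its first round, with sampled totals `T`. -/
def startState (n : ℕ) (θ T : Fin d → ℝ) : State d :=
  (fun i => ⟨T i, T i, armsRho n (θ i), 0, 0, 0, false⟩, ⟨0, 0⟩)

/-- The output of the iterative algorithm with sampled totals `T` and uniforms `u`. -/
def iterOutput (n : ℕ) (J : (Fin d → Bool) → ℝ) (θ T : Fin d → ℝ) (u : Fin n → Fin d → ℝ)
    (i : Fin d) : ℝ :=
  let a := loopState (fun k => iterRound n J θ (k + 1)) n (startState n θ T) u
  ((a.1 i).finish a.2.meanJ).g

theorem iterARMSLaw_eq_map_iterOutput (hn : 1 ≤ n) :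
    iterARMSLaw d n J θ = ((Measure.pi fun _ : Fin d => gammaNat n).prod
      (Measure.pi fun _ : Fin n => Measure.pi fun _ : Fin d => unif)).map
        fun p => iterOutput n J θ p.1 p.2 := by
  have h_program : Simulates (Represents n θ 0) (Represents n θ n) ((iterARMS d).run J) _ _ :=
    simulates_resetMean.const_comp <| simulates_resetAccumulators.const_comp <|
      simulates_drawTotals.comp <| (simulates_setRho hn).const_comp <|
        (simulates_mainLoop hn).comp_const <| simulates_finish.comp_const .id
  have h_init : Represents n θ 0 (initState n θ)
      (fun _ => ⟨0, 0, 0, 0, 0, 0, false⟩, ⟨0, 0⟩) :=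
    ⟨fun i x => by cases x <;> simp [initState, Coord.encode], rfl, by simp [initState], rfl, rfl⟩
  exact h_program.map_eq (f := output) (g := fun a i => (a.1 i).g)
    (measurable_pi_iff.2 fun i => measurable_pi_apply _)
    (fun σ a h => funext fun i => h.vec i .g) h_init

end PureAlgorithm

section LoopInvariant

variable {d n m : ℕ} {J : (Fin d → Bool) → ℝ} {θ : Fin d → ℝ}

/-- The randomness of the iterative algorithm, sorted by coordinates. The uniforms of the last
round are dropped, since that round takes the whole remaining sum. -/
def sortSource (ω : (Fin d → ℝ) × (Fin n → Fin d → ℝ)) (i : Fin d) : ℝ × (Fin (n - 1) → ℝ) :=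
  (ω.1 i, fun k => ω.2 (Fin.castLE (Nat.sub_le n 1) k) i)

/-- The sample obtained in round `k + 1` when the coordinates run the iterative procedure with
randomness `p`. -/
def roundBits (n : ℕ) (θ : Fin d → ℝ) (p : Fin d → ℝ × (Fin (n - 1) → ℝ)) (k : ℕ)
    (i : Fin d) : Bool :=
  armsBit (θ i)
    (1 - (1 - iterDraw n (p i).2 k (iterRem n (p i).1 (p i).2 k) / (p i).1) ^ (n - 1))

/-- The invariant of the main loop: after `m` rounds the state `a` holds the remaining sums, and
the accumulators hold the averages over the first `m` samples. The averages of scores have the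
denominator `m - 1`, which is replaced by `1` for `m ≤ 1`. -/
structure LoopInvariant (n : ℕ) (J : (Fin d → Bool) → ℝ) (θ : Fin d → ℝ)
    (p : Fin d → ℝ × (Fin (n - 1) → ℝ)) (m : ℕ) (a : State d) : Prop where
  total : ∀ i, (a.1 i).total = (p i).1
  rem : ∀ i, (a.1 i).rem = iterRem n (p i).1 (p i).2 m
  rho : ∀ i, (a.1 i).rho = armsRho n (θ i)
  meanJ : a.2.meanJ = 1 / (m : ℝ) * ∑ k ∈ Finset.range m, J (roundBits n θ p k)
  accS : ∀ i, (a.1 i).accS = 1 / max ((m : ℝ) - 1) 1 *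
    ∑ k ∈ Finset.range m, scoreCoord (θ i) (roundBits n θ p k i)
  accJS : ∀ i, (a.1 i).accJS = 1 / max ((m : ℝ) - 1) 1 *
    ∑ k ∈ Finset.range m, J (roundBits n θ p k) * scoreCoord (θ i) (roundBits n θ p k i)

theorem runningMean_succ (f : ℕ → ℝ) (m : ℕ) :
    (((m + 1 : ℕ) : ℝ) - 1) / (m + 1 : ℕ) * (1 / m * ∑ k ∈ Finset.range m, f k) +
        1 / (m + 1 : ℕ) * f m =
      1 / (m + 1 : ℕ) * ∑ k ∈ Finset.range (m + 1), f k := by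
  rcases Nat.eq_zero_or_pos m with rfl | hm
  · simp
  · rw [Finset.sum_range_succ]
    push_cast
    field_simp
    ring

theorem accumulate_succ (f : ℕ → ℝ) (m : ℕ) :
    accumulate (m + 1) (1 / max ((m : ℝ) - 1) 1 * ∑ k ∈ Finset.range m, f k) (f m) =
      1 / max (((m + 1 : ℕ) : ℝ) - 1) 1 * ∑ k ∈ Finset.range (m + 1), f k := by
  have h_sub : ((m + 1 : ℕ) : ℝ) - 2 = m - 1 := by push_cast; ring
  have h_pos (x : ℝ) : 0 < max x 1 := lt_max_of_lt_right one_pos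
  have := h_pos ((m : ℝ) - 1)
  have := h_pos (((m + 1 : ℕ) : ℝ) - 1)
  rw [accumulate, h_sub, Finset.sum_range_succ]
  field_simp

theorem draw_succ (ω : (Fin d → ℝ) × (Fin n → Fin d → ℝ)) (hm : m < n) (i : Fin d) (r : ℝ) :
    draw n (m + 1) r (ω.2 ⟨m, hm⟩ i) = iterDraw n (sortSource ω i).2 m r := by
  by_cases h : m + 1 < n
  · rw [draw, if_pos h, iterDraw, dif_pos (by omega)]
    rfl
  · rw [draw, if_neg h, iterDraw, dif_neg (by omega)]

theorem loopInvariant_start (ω : (Fin d → ℝ) × (Fin n → Fin d → ℝ)) :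
    LoopInvariant n J θ (sortSource ω) 0 (startState n θ ω.1) := by
  constructor <;> simp [startState, sortSource, iterRem]

theorem LoopInvariant.succ {ω : (Fin d → ℝ) × (Fin n → Fin d → ℝ)} {a : State d}
    (h : LoopInvariant n J θ (sortSource ω) m a) (hm : m < n) :
    LoopInvariant n J θ (sortSource ω) (m + 1) (iterRound n J θ (m + 1) a (ω.2 ⟨m, hm⟩)) := by
  have h_draw (i) : draw n (m + 1) (a.1 i).rem (ω.2 ⟨m, hm⟩ i) = iterDraw n (sortSource ω i).2 m
      (iterRem n (sortSource ω i).1 (sortSource ω i).2 m) := by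
    rw [draw_succ, h.rem]
  have h_bit (i) : ((a.1 i).split n (θ i) (draw n (m + 1) (a.1 i).rem (ω.2 ⟨m, hm⟩ i))).z =
      roundBits n θ (sortSource ω) m i := by
    rw [Coord.split, h_draw, h.total, roundBits]
  have h_bits := funext h_bit
  constructor
  case total => exact h.total
  case rho => exact h.rho
  case rem =>
    intro i
    rw [iterRem, ← h_draw, ← h.rem]
    rfl
  case meanJ =>
    rw [← runningMean_succ, ← h.meanJ, ← h_bits]
    rfl
  case accS =>
    intro i
    rw [← accumulate_succ, ← h.accS, ← h_bit]
    rfl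
  case accJS =>
    intro i
    rw [← accumulate_succ fun k =>
      J (roundBits n θ (sortSource ω) k) * scoreCoord (θ i) (roundBits n θ (sortSource ω) k i),
      ← h.accJS, ← h_bit, ← h_bits]
    rfl

theorem loopInvariant_loopState (ω : (Fin d → ℝ) × (Fin n → Fin d → ℝ)) (hm : m ≤ n) :
    LoopInvariant n J θ (sortSource ω) m
      (loopState (fun k => iterRound n J θ (k + 1)) m (startState n θ ω.1)
        fun k => ω.2 (Fin.castLE hm k)) := by
  induction m with
  | zero => exact loopInvariant_start ω
  | succ m ih => exact (ih (by omega)).succ hm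

end LoopInvariant

section Estimator

variable {d n : ℕ} (J : (Fin d → Bool) → ℝ)

theorem bernProb_update (θ : Fin d → ℝ) (z : Fin d → Bool) (i : Fin d) (t : ℝ) :
    bernProb (Function.update θ i t) z =
      (if z i then t else 1 - t) * ∏ k ∈ Finset.univ.erase i, if z k then θ k else 1 - θ k := by
  rw [bernProb, ← Finset.mul_prod_erase _ _ (Finset.mem_univ i), Function.update_self]
  congr 1
  refine Finset.prod_congr rfl fun k hk => ?_
  rw [Function.update_of_ne (Finset.ne_of_mem_erase hk)]

theorem score_eq {θ : Fin d → ℝ} (hθ : ∀ i, θ i ∈ Set.Ioo 0 1) (z : Fin d → Bool) (i : Fin d) :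
    score θ z i = scoreCoord (θ i) (z i) := by
  have h_pos (k) : 0 < if z k then θ k else 1 - θ k := by
    split_ifs
    exacts [(hθ k).1, sub_pos.2 (hθ k).2]
  have h_rest := (Finset.prod_pos fun k (_ : k ∈ Finset.univ.erase i) => h_pos k).ne'
  have h_deriv : HasDerivAt (fun t => if z i then t else 1 - t) (if z i then 1 else -1) (θ i) := by
    split_ifs
    exacts [hasDerivAt_id' _, (hasDerivAt_id' _).const_sub 1]
  have h_log := (h_deriv.mul_const _).log (mul_ne_zero (h_pos i).ne' h_rest)
  simp only [score, bernProb_update]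
  rw [h_log.deriv, mul_div_mul_right _ _ h_rest, scoreCoord]
  split_ifs
  exacts [rfl, neg_div _ _]

theorem loorf_eq (hn : 2 ≤ n) (θ : Fin d → ℝ) (z : Fin n → Fin d → Bool) (i : Fin d) :
    loorf J θ z i =
      1 / ((n : ℝ) - 1) * ∑ s, J (z s) * score θ (z s) i -
        1 / ((n : ℝ) - 1) * (∑ s, score θ (z s) i) * (1 / (n : ℝ) * ∑ s, J (z s)) := by
  have h_two : (2 : ℝ) ≤ n := by exact_mod_cast hn
  have hn₀ : (n : ℝ) ≠ 0 := by positivity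
  have hn₁ : (n : ℝ) - 1 ≠ 0 := by linarith
  simp only [loorf, Finset.sum_erase_eq_sub (Finset.mem_univ _)]
  set A := ∑ t, J (z t)
  have h_term (s) : (J (z s) - 1 / ((n : ℝ) - 1) * (A - J (z s))) * score θ (z s) i =
      n / ((n : ℝ) - 1) * (J (z s) * score θ (z s) i) -
        A / ((n : ℝ) - 1) * score θ (z s) i := by
    field_simp
    ring
  simp only [h_term, Finset.sum_sub_distrib, ← Finset.mul_sum]
  field_simp

/-- The ARMS estimator as a function of the copula uniforms `w`. -/
def estimator (θ : Fin d → ℝ) (w : Fin d → Fin n → ℝ) (i : Fin d) : ℝ :=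
  1 / (1 - armsRho n (θ i)) * loorf J θ (fun s j => armsBit (θ j) (w j s)) i

theorem measurable_armsBit (t : ℝ) : Measurable (armsBit t) := by
  unfold armsBit
  split_ifs <;> refine measurable_to_bool ?_
  · have h_preimage : (fun w => decide (w ≤ t)) ⁻¹' {true} = Iic t := by ext; simp
    exact h_preimage ▸ measurableSet_Iic
  · have h_preimage : (fun w => decide (1 - w ≤ t)) ⁻¹' {true} = Ici (1 - t) := by
      ext
      simp [add_comm]
    exact h_preimage ▸ measurableSet_Ici

theorem measurable_estimator (θ : Fin d → ℝ) : Measurable (estimator (n := n) J θ) := by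
  have h_bits : Measurable fun (w : Fin d → Fin n → ℝ) (s : Fin n) (j : Fin d) =>
      armsBit (θ j) (w j s) :=
    measurable_pi_iff.2 fun s => measurable_pi_iff.2 fun j =>
      (measurable_armsBit (θ j)).comp (by fun_prop)
  refine measurable_pi_iff.2 fun i => Measurable.const_mul ?_ _
  exact (measurable_of_finite fun z : Fin n → Fin d → Bool => loorf J θ z i).comp h_bits

theorem iterOutput_eq_estimator (hn : 2 ≤ n) {θ : Fin d → ℝ} (hθ : ∀ i, θ i ∈ Set.Ioo 0 1)
    (ω : (Fin d → ℝ) × (Fin n → Fin d → ℝ)) :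
    iterOutput n J θ ω.1 ω.2 =
      estimator J θ fun i => copula (iterDir (n := n) (sortSource ω i)) := by
  have h_max : max ((n : ℝ) - 1) 1 = n - 1 :=
    max_eq_left <| by linarith [show (2 : ℝ) ≤ n by exact_mod_cast hn]
  have h : LoopInvariant n J θ (sortSource ω) n
      (loopState (fun k => iterRound n J θ (k + 1)) n (startState n θ ω.1) ω.2) :=
    loopInvariant_loopState ω le_rfl
  ext i
  rw [iterOutput, Coord.finish, estimator, loorf_eq J hn, h.rho, h.accJS, h.accS, h.meanJ, h_max]
  simp only [Finset.sum_range, score_eq hθ]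
  rfl

end Estimator

section Law

theorem measurePreserving_piCurry {α : Type*} [MeasurableSpace α] (μ : Measure α)
    [IsProbabilityMeasure μ] (ι κ : Type*) [Fintype ι] [Fintype κ] :
    MeasurePreserving (MeasurableEquiv.curry ι κ α) (Measure.pi fun _ => μ)
      (Measure.pi fun _ => Measure.pi fun _ => μ) where
  measurable := MeasurableEquiv.measurable _
  map_eq := by
    simpa only [Measure.infinitePi_eq_pi] using
      Measure.infinitePi_map_curry fun (_ : ι) (_ : κ) => μ

theorem measurePreserving_piSwap {α : Type*} [MeasurableSpace α] (μ : Measure α)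
    [IsProbabilityMeasure μ] (ι κ : Type*) [Fintype ι] [Fintype κ] :
    MeasurePreserving (fun (u : ι → κ → α) k i => u i k)
      (Measure.pi fun _ => Measure.pi fun _ => μ) (Measure.pi fun _ => Measure.pi fun _ => μ) :=
  (measurePreserving_piCurry μ κ ι).comp <|
    (measurePreserving_piCongrLeft (fun _ : κ × ι => μ) (Equiv.prodComm ι κ)).comp
      (measurePreserving_piCurry μ ι κ).symm

theorem measurePreserving_init {α : Type*} [MeasurableSpace α] (μ : Measure α)
    [IsProbabilityMeasure μ] (m : ℕ) :
    MeasurePreserving (fun x : Fin (m + 1) → α => Fin.init x)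
      (Measure.pi fun _ => μ) (Measure.pi fun _ => μ) :=
  measurePreserving_fst.comp (measurePreserving_init_last m)

variable {d n : ℕ}

theorem measurePreserving_sortSource (hn : 1 ≤ n) :
    MeasurePreserving (sortSource (d := d) (n := n))
      ((Measure.pi fun _ => gammaNat n).prod (Measure.pi fun _ => Measure.pi fun _ => unif))
      (Measure.pi fun _ => iterSource n) := by
  obtain ⟨m, rfl⟩ : ∃ m, n = m + 1 := ⟨n - 1, by omega⟩
  have h_gamma : gammaNat (m + 1) = gammaMeasure ((m + 1 : ℕ) : ℝ) 1 := if_neg (by simp)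
  have h_uniforms : MeasurePreserving (fun (u : Fin (m + 1) → Fin d → ℝ) i k => Fin.init u k i)
      (Measure.pi fun _ => Measure.pi fun _ => unif) (Measure.pi fun _ => iidUnif m) :=
    (measurePreserving_piSwap unif _ _).comp (measurePreserving_init _ m)
  have h_zip := (measurePreserving_arrowProdEquivProdArrow ℝ (Fin m → ℝ) (Fin d)
    (fun _ => gammaNat (m + 1)) fun _ => iidUnif m).symm
  simp only [iterSource, ← h_gamma]
  exact h_zip.comp ((MeasurePreserving.id _).prod h_uniforms)

theorem iterARMSLaw_eq (hn : 2 ≤ n) (J : (Fin d → Bool) → ℝ) {θ : Fin d → ℝ}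
    (hθ : ∀ i, θ i ∈ Set.Ioo 0 1) : iterARMSLaw d n J θ = origARMSLaw d n J θ := by
  let F (e : Fin d → Fin n → ℝ) := estimator J θ fun i => copula (normalize (e i))
  have hF : Measurable F := (measurable_estimator J θ).comp (by fun_prop)
  have hn₁ : 1 ≤ n := by omega
  have := isProbabilityMeasure_expMeasure one_pos
  have h_orig := measurePreserving_pi (fun _ : Fin d => iidUnif n)
    (fun _ => Measure.pi fun _ => expMeasure 1) fun _ => measurePreserving_origE n
  have h_iter := (measurePreserving_pi (fun _ : Fin d => iterSource n)
    (fun _ => Measure.pi fun _ => expMeasure 1) fun _ => measurePreserving_iterE hn₁).comp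
      (measurePreserving_sortSource hn₁)
  calc iterARMSLaw d n J θ
    _ = ((Measure.pi fun _ => gammaNat n).prod (Measure.pi fun _ => Measure.pi fun _ => unif)).map
        fun ω => F fun i => iterE (sortSource ω i) := by
      simp only [iterARMSLaw_eq_map_iterOutput hn₁, iterOutput_eq_estimator J hn hθ, F,
        normalize_iterE hn₁]
    _ = (Measure.pi fun _ => Measure.pi fun _ => expMeasure 1).map F := by
      rw [← h_iter.map_eq, Measure.map_map hF h_iter.measurable]
      rfl
    _ = (Measure.pi fun _ => iidUnif n).map fun u => F fun i => origE (u i) := by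
      rw [← h_orig.map_eq, Measure.map_map hF h_orig.measurable]
      rfl
    _ = origARMSLaw d n J θ := by
      simp only [F, normalize_origE]
      rfl

end Law

section Memory

variable {ι : Type} {d K : ℕ}

theorem scratch_block_le {l : List (Cmd ι d)} (h : ∀ c ∈ l, c.scratch ≤ K) :
    (Cmd.block l).scratch ≤ K := by
  induction l with
  | nil => exact Nat.zero_le _
  | cons c l ih =>
    exact max_le (h c List.mem_cons_self) (ih fun c' hc' => h c' (List.mem_cons_of_mem _ hc'))

theorem scratch_forDim_le {f : Fin d → Cmd ι d} (h : ∀ i, (f i).scratch ≤ K) :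
    (Cmd.forDim f).scratch ≤ K :=
  scratch_block_le <| List.forall_mem_map.2 fun i _ => h i

theorem card_reg (d : ℕ) : Fintype.card (Reg d) = 8 * d + 8 := by
  rw [Fintype.card_sum, Fintype.card_prod, Fintype.card_fin]
  rfl

theorem scratch_roundCmd_le (d : ℕ) : (roundCmd d).scratch ≤ d + 50 := by
  refine scratch_block_le ?_
  simp only [List.forall_mem_cons]
  refine ⟨scratch_forDim_le fun _ => ?_, ?_, ?_, scratch_forDim_le fun _ => ?_,
    List.forall_mem_nil _⟩
  · simp [sampleCmd, Cmd.block, Cmd.scratch, Expr.size]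
  · simp [Cmd.scratch]
  · simp [Cmd.scratch, Expr.size]
  · simp [Cmd.scratch, Expr.size, accExpr, scoreExpr]

theorem scratch_iterARMS_le (d : ℕ) : (iterARMS d).scratch ≤ d + 52 := by
  refine scratch_block_le ?_
  simp only [List.forall_mem_cons]
  refine ⟨?_, scratch_forDim_le fun _ => ?_, scratch_forDim_le fun _ => ?_,
    scratch_forDim_le fun _ => ?_, Nat.add_le_add_right (scratch_roundCmd_le d) 2,
    scratch_forDim_le fun _ => ?_, List.forall_mem_nil _⟩
  all_goals simp [rhoCmd, rhoExpr, Cmd.scratch, Expr.size]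

theorem memory_iterARMS_le (hd : 1 ≤ d) : (iterARMS d).memory ≤ 100 * d := by
  have h_scratch := scratch_iterARMS_le d
  rw [Cmd.memory, card_reg]
  omega

end Memory

end ARMS

end

theorem mainTheorem6 :
    (∀ n : ℕ, 1 ≤ n →
      (ARMS.iidUnif n).map (fun u => ∑ s, ARMS.origE u s) = gammaMeasure n 1 ∧
      (∀ s : Fin n, (s : ℕ) + 1 < n →
        condDistrib (fun u => ARMS.origE u s) (fun u => ∑ t ∈ Finset.Ici s, ARMS.origE u t)
            (ARMS.iidUnif n)
          =ᵐ[(ARMS.iidUnif n).map fun u => ∑ t ∈ Finset.Ici s, ARMS.origE u t]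
            fun r => ARMS.unif.map (ARMS.invDraw n ((s : ℕ) + 1) r)) ∧
      (∀ p : ℝ × (Fin (n - 1) → ℝ), ∑ s, ARMS.iterE (n := n) p s = p.1) ∧
      (ARMS.iterSource n).map (ARMS.iterE (n := n)) =
        (ARMS.iidUnif n).map ARMS.origE ∧
      (ARMS.iterSource n).map (ARMS.iterDir (n := n)) =
        (ARMS.iidUnif n).map ARMS.origDir ∧
      (ARMS.iterSource n).map (fun p => ARMS.copula (ARMS.iterDir (n := n) p)) =
        (ARMS.iidUnif n).map (fun u => ARMS.copula (ARMS.origDir u))) ∧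
    (∃ C : ℕ, ∀ d : ℕ, 1 ≤ d →
      (ARMS.iterARMS d).memory ≤ C * d ∧
      ∀ n : ℕ, 2 ≤ n → ∀ (J : (Fin d → Bool) → ℝ) (θ : Fin d → ℝ),
        (∀ i, θ i ∈ Set.Ioo (0 : ℝ) 1) →
          ARMS.iterARMSLaw d n J θ = ARMS.origARMSLaw d n J θ) :=
  ⟨fun _ hn => ⟨ARMS.map_sum_origE hn, ARMS.condDistrib_origE, ARMS.sum_iterE hn,
    ARMS.map_iterE hn, ARMS.map_comp_iterDir hn measurable_id,
    ARMS.map_comp_iterDir hn ARMS.measurable_copula⟩,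
    100, fun _ hd => ⟨ARMS.memory_iterARMS_le hd,
      fun _ hn J _ hθ => ARMS.iterARMSLaw_eq hn J hθ⟩⟩
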